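/- For $n \ge 1$ let $K_n = \{\tau \in \mathbb{R}^n : \tau_1 < \dots < \tau_n\}$. For nondecreasing nodes $\tau_1 \le \dots \le \tau_n$, write $[\tau_1, \dots, \tau_n] f$ for the divided difference of $f$ (equal to $f^{(n-1)}(\tau_1)/(n-1)!$ if all nodes coincide, and to $([\tau_2,\dots,\tau_n]f - [\tau_1,\dots,\tau_{n-1}]f)/(\tau_n-\tau_1)$ if $\tau_1 < \tau_n$), let $y_+^p = y^p$ for $y > 0$ and $y_+^p = 0$ for $y \le 0$, and for an integer $p \ge 0$ and nondecreasing $\tau \in \mathbb{R}^{p+2}$ put $$N_p(\tau)(x) = [\tau_1, \dots, \tau_{p+2}]\,(\bullet - x)_+^p, \qquad B_p(\tau)(x) = (\tau_{p+2} - \tau_1)\, N_p(\tau)(x), \qquad x \in \mathbb{R}.$$ At repeated knots, $N_p(\tau)$ is the tempered distribution obtained as the divided difference of the distribution-valued map $t \mapsto (t - x)_+^p$; thus $N_0(z,z) = \delta_z$. For a knot vector $\tau$, let $\tau\triangleleft$ and $\tau\triangleright$ be $\tau$ without its first and last entry, respectively, and let $\tau \oplus x$ be $\tau$ with $x$ inserted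 so that the order is kept. Let $H^s(\mathbb{R})$, $s \in \mathbb{R}$, be the $L^2$-based Sobolev (Bessel potential) space with its norm. Let $p \ge 0$ and $\tau \in K_{p+2}$. Then: 1. $B_p(\tau) \in H^{p-1}(\mathbb{R})$, and its distributional derivative $\partial_x B_p(\tau)$ belongs to $H^{p-1}(\mathbb{R})$. It is given by $$\partial_x B_0(\tau) = \delta_{\tau_1} - \delta_{\tau_2},$$ where $\delta_z \in H^{-1}(\mathbb{R})$ is the Dirac distribution at $z \in \mathbb{R}$, and, for $p \ge 1$, by $$\partial_x B_p(\tau) = -p \left( N_{p-1}(\tau\triangleleft) - N_{p-1}(\tau\triangleright) \right).$$ 2. For every $i \in \{1, \dots, p+2\}$, the map $B_p : K_{p+2} \to H^{p-1}(\mathbb{R})$ is differentiable at $\tau$ with respect to its $i$-th argument, in the norm of $H^{p-1}(\mathbb{R})$, with derivative $$\partial_i B_p(\tau) = N_p([\tau \oplus \tau_i]\triangleleft)\, \delta_{i \ne 1} - N_p([\tau \oplus \tau_i]\triangleright)\, \delta_{i \ne p+2} \in H^{p-1}(\mathbb{R}),$$ where $\delta_{i \ne j}$ is $1$ if $i \ne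 j$ and $0$ if $i = j$. For $p \ge 1$ the right-hand side is (almost everywhere) the function given by the pointwise definition of $N_p$. -/

import Mathlib

open MeasureTheory TemperedDistribution
open scoped SchwartzMap

noncomputable section

namespace FreeKnot

/-! ### Knot vectors

A knot vector with `n` knots is a map `Fin n → ℝ`; the knot written `τ_{i+1}` on paper is `τ i`.
Removing the first (last) knot is `Fin.tail` (`Fin.init`). -/

/-- The parameter space of knot vectors: ordered, pairwise distinct knots. -/
def knotVectors (n : ℕ) : Set (Fin n → ℝ) := {τ | StrictMono τ}

/-- The width of a knot vector with at least one knot. -/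
def width {n : ℕ} (τ : Fin (n + 1) → ℝ) : ℝ := τ (Fin.last n) - τ 0

/-- The number of knots that are at most `x`. -/
def countLE {n : ℕ} (τ : Fin n → ℝ) (x : ℝ) : Fin (n + 1) :=
  ⟨(Finset.univ.filter fun j => τ j ≤ x).card,
    Nat.lt_succ_of_le ((Finset.card_filter_le _ _).trans (by simp))⟩

/-- Insertion of `x` into an ordered knot vector, keeping the order:
`(τ_1, …, τ_k, x, τ_{k+1}, …, τ_n)` with `τ_k ≤ x < τ_{k+1}`. -/
def insertKnot {n : ℕ} (τ : Fin n → ℝ) (x : ℝ) : Fin (n + 1) → ℝ :=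
  Fin.insertNth (α := fun _ => ℝ) (countLE τ x) x τ

/-! ### Divided differences and B-splines -/

/-- The divided difference `[τ_1, …, τ_{n+1}] f` at nondecreasing, possibly repeated nodes,
for a function with values in a topological vector space: `f^{(n)}(τ_1) / n!` if all nodes
coincide, and the usual quotient of divided differences of lower order otherwise. -/
def dividedDiff {E : Type*} [AddCommGroup E] [Module ℝ E] [TopologicalSpace E] (f : ℝ → E) :
    (n : ℕ) → (Fin (n + 1) → ℝ) → E
  | 0, τ => f (τ 0)
  | n + 1, τ =>
    if τ 0 = τ (Fin.last (n + 1)) then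
      ((n + 1).factorial : ℝ)⁻¹ • (deriv^[n + 1] f) (τ 0)
    else
      (τ (Fin.last (n + 1)) - τ 0)⁻¹ •
        (dividedDiff f n (Fin.tail τ) - dividedDiff f n (Fin.init τ))

/-- The truncated power `y_+^p`, with `y_+^0` the indicator function of `y > 0`. -/
def truncPow (p : ℕ) (y : ℝ) : ℝ := if 0 < y then y ^ p else 0

/-- The normalised B-spline `N_p(τ)(x) = [τ_1, …, τ_{p+2}] (• - x)_+^p`, as a function. -/
def normBSpline (p : ℕ) (τ : Fin (p + 2) → ℝ) (x : ℝ) : ℝ :=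
  dividedDiff (fun t => truncPow p (t - x)) (p + 1) τ

/-- The B-spline `B_p(τ)(x) = |τ| [τ_1, …, τ_{p+2}] (• - x)_+^p`, as a function. -/
def bSpline (p : ℕ) (τ : Fin (p + 2) → ℝ) (x : ℝ) : ℝ :=
  width τ * dividedDiff (fun t => truncPow p (t - x)) (p + 1) τ

/-! ### Functions as tempered distributions -/

/-- The function becomes integrable after division by a power of `1 + |x|`. -/
def IsTempered (f : ℝ → ℝ) : Prop :=
  ∃ k : ℕ, Integrable (fun x => ((1 + |x|) ^ k)⁻¹ * f x)

theorem IsTempered.aux {f : ℝ → ℝ} {k : ℕ}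
    (φ : 𝓢(ℝ, ℂ)) (x : ℝ) :
    ‖φ x * (f x : ℂ)‖ ≤
      (2 ^ k * ((Finset.Iic (k, 0)).sup (schwartzSeminormFamily ℂ ℝ ℂ)) φ) *
        ‖((1 + |x|) ^ k)⁻¹ * f x‖ := by
  have h := SchwartzMap.one_add_le_sup_seminorm_apply (𝕜 := ℂ) (m := (k, 0)) (k := k) (n := 0)
    le_rfl le_rfl φ x
  rw [norm_iteratedFDeriv_zero, Real.norm_eq_abs] at h
  have hpos : 0 < (1 + |x|) ^ k := by positivity
  rw [norm_mul, Complex.norm_real, norm_mul, norm_inv, Real.norm_of_nonneg hpos.le, ← mul_assoc]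
  refine mul_le_mul_of_nonneg_right ?_ (norm_nonneg _)
  rw [← div_eq_mul_inv, le_div_iff₀ hpos, mul_comm]
  exact h

theorem IsTempered.integrable_mul {f : ℝ → ℝ} (hf : IsTempered f) (φ : 𝓢(ℝ, ℂ)) :
    Integrable (fun x => φ x * (f x : ℂ)) := by
  obtain ⟨k, hk⟩ := hf
  refine (hk.norm.const_mul _).mono' ?_ (Filter.Eventually.of_forall (IsTempered.aux φ))
  have h1 : AEStronglyMeasurable f volume := by
    have : f = fun x => (1 + |x|) ^ k * (((1 + |x|) ^ k)⁻¹ * f x) := by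
      funext x
      have hpos : (1 + |x|) ^ k ≠ 0 := by positivity
      field_simp
    rw [this]
    exact (Continuous.aestronglyMeasurable (by fun_prop)).mul hk.aestronglyMeasurable
  exact φ.continuous.aestronglyMeasurable.mul
    (Complex.continuous_ofReal.comp_aestronglyMeasurable h1)

open Classical in
/-- The tempered distribution `φ ↦ ∫ φ f` given by a tempered function `f`
(and `0` if `f` is not tempered). -/
def toDist (f : ℝ → ℝ) : 𝓢'(ℝ, ℂ) :=
  if hf : IsTempered f then
    ContinuousLinearMap.toPointwiseConvergenceCLM _ _ _ _
      (SchwartzMap.mkCLMtoNormedSpace (𝕜 := ℂ) (σ := RingHom.id ℂ)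
        (fun φ : 𝓢(ℝ, ℂ) => ∫ x, φ x * (f x : ℂ))
        (fun φ ψ => by
          rw [← integral_add (hf.integrable_mul φ) (hf.integrable_mul ψ)]
          simp [add_mul])
        (fun a φ => by
          rw [RingHom.id_apply, smul_eq_mul, ← integral_const_mul]
          simp [mul_assoc])
        (by
          obtain ⟨k, hk⟩ := id hf
          refine ⟨Finset.Iic (k, 0), (∫ x, ‖((1 + |x|) ^ k)⁻¹ * f x‖) * 2 ^ k, by positivity,
            fun φ => ?_⟩
          refine (norm_integral_le_of_norm_le (hk.norm.const_mul _)
            (Filter.Eventually.of_forall (IsTempered.aux φ))).trans (le_of_eq ?_)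
          rw [integral_const_mul]
          ring))
  else 0

theorem toDist_apply {f : ℝ → ℝ} (hf : IsTempered f) (φ : 𝓢(ℝ, ℂ)) :
    toDist f φ = ∫ x, φ x * (f x : ℂ) := by
  rw [toDist, dif_pos hf]
  rfl

/-- The truncated power `x ↦ (t - x)_+^p` as a tempered distribution in `x`. -/
def truncPowDist (p : ℕ) (t : ℝ) : 𝓢'(ℝ, ℂ) := toDist fun x => truncPow p (t - x)

/-- The normalised B-spline `N_p(τ) = [τ_1, …, τ_{p+2}] (• - x)_+^p` as a tempered distribution:
the divided difference is that of the distribution-valued map `t ↦ (t - x)_+^p`. At distinct knots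
this is the distribution given by the function `normBSpline p τ`; at repeated knots it also covers
the case where `N_p(τ)` is not a function, such as the Dirac distribution `N_0(z, z)`. -/
def normBSplineDist (p : ℕ) (τ : Fin (p + 2) → ℝ) : 𝓢'(ℝ, ℂ) :=
  dividedDiff (truncPowDist p) (p + 1) τ

/-! ### The Sobolev space `H^s(ℝ)` as a normed space -/

/-- The tempered distributions in `H^s(ℝ)`. -/
def sobolevSubmodule (s : ℝ) : Submodule ℂ 𝓢'(ℝ, ℂ) where
  carrier := {u | MemSobolev s 2 u}
  add_mem' := MemSobolev.add
  zero_mem' := memSobolev_fun_zero ℝ ℂ s 2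
  smul_mem' c _ hu := hu.smul c

/-- The Sobolev space `H^s(ℝ)`; it carries the Bessel potential norm, see below. -/
def Sobolev (s : ℝ) : Type := sobolevSubmodule s

instance (s : ℝ) : AddCommGroup (Sobolev s) := inferInstanceAs (AddCommGroup (sobolevSubmodule s))

instance (s : ℝ) : Module ℂ (Sobolev s) := inferInstanceAs (Module ℂ (sobolevSubmodule s))

/-- The underlying tempered distribution. -/
def Sobolev.toDistribution {s : ℝ} : Sobolev s →ₗ[ℂ] 𝓢'(ℝ, ℂ) := (sobolevSubmodule s).subtype

theorem Sobolev.toDistribution_injective (s : ℝ) :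
    Function.Injective (Sobolev.toDistribution (s := s)) := Subtype.val_injective

theorem toTemperedDistribution_injective :
    Function.Injective (Lp.toTemperedDistributionCLM ℂ (volume : Measure ℝ) 2) :=
  LinearMap.ker_eq_bot.mp Lp.ker_toTemperedDistributionCLM_eq_bot

/-- The `L²` function that represents the Bessel potential of order `s` of `u ∈ H^s(ℝ)`. -/
def Sobolev.besselLp {s : ℝ} (u : Sobolev s) : Lp ℂ 2 (volume : Measure ℝ) :=
  Classical.choose (show MemSobolev s 2 (Sobolev.toDistribution u) from Subtype.property u)

theorem Sobolev.besselLp_spec {s : ℝ} (u : Sobolev s) :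
    Lp.toTemperedDistributionCLM ℂ (volume : Measure ℝ) 2 u.besselLp =
      besselPotential ℝ ℂ s (Sobolev.toDistribution u) :=
  (Classical.choose_spec
    (show MemSobolev s 2 (Sobolev.toDistribution u) from Subtype.property u)).symm

/-- The Bessel potential as a linear map `H^s(ℝ) → L²(ℝ)`. -/
def Sobolev.besselLpₗ (s : ℝ) : Sobolev s →ₗ[ℂ] Lp ℂ 2 (volume : Measure ℝ) where
  toFun := Sobolev.besselLp
  map_add' u v := toTemperedDistribution_injective (by
    simp only [map_add, Sobolev.besselLp_spec])
  map_smul' c u := toTemperedDistribution_injective (by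
    simp only [map_smul, RingHom.id_apply, Sobolev.besselLp_spec])

theorem Sobolev.besselLpₗ_injective (s : ℝ) : Function.Injective (Sobolev.besselLpₗ s) := by
  intro u v h
  apply Sobolev.toDistribution_injective
  have h' : besselPotential ℝ ℂ s (Sobolev.toDistribution u) =
      besselPotential ℝ ℂ s (Sobolev.toDistribution v) := by
    rw [← Sobolev.besselLp_spec, ← Sobolev.besselLp_spec]
    exact congrArg _ h
  have h'' := congrArg (besselPotential ℝ ℂ (-s)) h'
  simpa using h''

/-- The norm of `H^s(ℝ)` is the `L²` norm of the Bessel potential of order `s`. -/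
instance (s : ℝ) : NormedAddCommGroup (Sobolev s) :=
  NormedAddCommGroup.induced _ _ (Sobolev.besselLpₗ s) (Sobolev.besselLpₗ_injective s)

instance (s : ℝ) : NormedSpace ℂ (Sobolev s) :=
  NormedSpace.induced ℂ _ _ (Sobolev.besselLpₗ s)

theorem Sobolev.norm_def {s : ℝ} (u : Sobolev s) : ‖u‖ = ‖u.besselLp‖ := rfl

open Classical in
/-- A tempered distribution in `H^s(ℝ)` as an element of the normed space `Sobolev s`
(and `0` if it is not in `H^s(ℝ)`). -/
def toSobolev (s : ℝ) (u : 𝓢'(ℝ, ℂ)) : Sobolev s :=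
  if hu : MemSobolev s 2 u then (⟨u, hu⟩ : sobolevSubmodule s) else 0

/-- The candidate for the derivative of `B_p` in the `i`-th knot, as a tempered distribution:
`N_p([τ ⊕ τ_i]◁) δ_{i ≠ 1} - N_p([τ ⊕ τ_i]▷) δ_{i ≠ p+2}`. -/
def knotDerivDist (p : ℕ) (τ : Fin (p + 2) → ℝ) (i : Fin (p + 2)) : 𝓢'(ℝ, ℂ) :=
  (if i ≠ 0 then normBSplineDist p (Fin.tail (insertKnot τ (τ i))) else 0) -
    (if i ≠ Fin.last (p + 1) then normBSplineDist p (Fin.init (insertKnot τ (τ i))) else 0)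

/-- The same expression, with the normalised B-splines as functions. -/
def knotDeriv (p : ℕ) (τ : Fin (p + 2) → ℝ) (i : Fin (p + 2)) (x : ℝ) : ℝ :=
  (if i ≠ 0 then normBSpline p (Fin.tail (insertKnot τ (τ i))) x else 0) -
    (if i ≠ Fin.last (p + 1) then normBSpline p (Fin.init (insertKnot τ (τ i))) x else 0)

end FreeKnot

end

noncomputable section

namespace FreeKnot

/-! ### Divided differences -/

section DividedDifferences

open Filter Topology

/-! Multiplying by the width cancels the outermost quotient, so `B_p(τ)` is the difference of two
divided differences of order `p` of the curve `t ↦ (t - x)_+^p`. For any differentiable curve in a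
normed space, the derivative of a divided difference in a node is the divided difference with that
node doubled (`hasDerivAt_dividedDiff`). Part 2 would follow at once if the truncated powers formed
a differentiable curve in `H^{p-1}`; but they grow at `-∞` and lie in no such space.

The remedy is a smooth cutoff left of all knots. The discarded piece is polynomial in `t` of degree
at most `p`, so divided differences of order `p + 1` annihilate it, also at double knots
(`normBSplineDist_eq_toDistribution`).

The cut-off curve is differentiable in `H^{p-1}` (`hasSobolevDerivAt_cutPow`). In `L²` this is
dominated convergence. Higher orders follow by induction: a curve is differentiable in `H^{s+1}` if
it and its spatial derivative are so in `H^s`, and the spatial derivative is a truncated power of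
one degree less plus a smooth term of compact support. Degree `0` comes from differentiating the
curve of degree `1` in space, which leads from `L²` to `H^{-1}` and produces the Dirac distribution.

Part 1 holds because `∂_x` commutes with divided differences and acts on truncated powers
explicitly. -/

theorem strictMono_tail {n : ℕ} {τ : Fin (n + 1) → ℝ} (h : StrictMono τ) :
    StrictMono (Fin.tail τ) :=
  fun _ _ hij => h (Fin.succ_lt_succ_iff.2 hij)

theorem strictMono_init {n : ℕ} {τ : Fin (n + 1) → ℝ} (h : StrictMono τ) :
    StrictMono (Fin.init τ) :=
  fun _ _ hij => h (Fin.castSucc_lt_castSucc_iff.2 hij)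

theorem tail_comp_predAbove_zero {n : ℕ} (τ : Fin (n + 1) → ℝ) :
    Fin.tail (τ ∘ Fin.predAbove 0) = τ := by
  funext k
  simp [Fin.tail]

theorem tail_comp_predAbove_succ {n : ℕ} (τ : Fin (n + 1) → ℝ) (j : Fin n) :
    Fin.tail (τ ∘ j.succ.predAbove) = Fin.tail τ ∘ j.predAbove := by
  funext k
  simp [Fin.tail]

theorem init_comp_predAbove_last {n : ℕ} (τ : Fin (n + 1) → ℝ) :
    Fin.init (τ ∘ (Fin.last n).predAbove) = τ := by
  funext k
  simp [Fin.init]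

theorem init_comp_predAbove_castSucc {n : ℕ} (τ : Fin (n + 1) → ℝ) (j : Fin n) :
    Fin.init (τ ∘ j.castSucc.predAbove) = Fin.init τ ∘ j.predAbove := by
  funext k
  simp [Fin.init]

/-- Exactly `i + 1` knots are at most `τ i`, so the copy lands directly after the original, and
`i.predAbove` is the monotone surjection that takes the value `i` twice. -/
theorem insertKnot_eq_comp_predAbove {n : ℕ} {τ : Fin n → ℝ} (hτ : StrictMono τ) (i : Fin n) :
    insertKnot τ (τ i) = τ ∘ i.predAbove := by
  have hc : countLE τ (τ i) = i.succ := by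
    apply Fin.ext
    have : (Finset.univ.filter fun j => τ j ≤ τ i) = Finset.Iic i := by
      ext j
      simp [hτ.le_iff_le]
    simp [countLE, this]
  rw [insertKnot, hc]
  funext j
  refine Fin.succAboveCases i.succ ?_ (fun k => ?_) j
  · rw [Fin.insertNth_apply_same]
    simp
  · rw [Fin.insertNth_apply_succAbove, Function.comp_apply]
    congr 1
    rcases lt_or_ge i k with h | h
    · rw [Fin.succAbove_of_le_castSucc _ _ (Fin.succ_le_castSucc_iff.2 h),
        Fin.predAbove_of_castSucc_lt _ _ (Fin.castSucc_lt_succ_iff.2 h.le), Fin.pred_succ]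
    · rw [Fin.succAbove_of_castSucc_lt _ _ (Fin.castSucc_lt_succ_iff.2 h),
        Fin.predAbove_of_le_castSucc _ _ (Fin.castSucc_le_castSucc_iff.2 h), Fin.castPred_castSucc]

/-- Knots that are strictly increasing up to double knots. -/
def AlmostStrictMono {n : ℕ} (σ : Fin n → ℝ) : Prop :=
  ∀ i j : Fin n, (i : ℕ) + 1 < j → σ i < σ j

theorem AlmostStrictMono.tail {n : ℕ} {σ : Fin (n + 1) → ℝ} (h : AlmostStrictMono σ) :
    AlmostStrictMono (Fin.tail σ) :=
  fun i j hij => h i.succ j.succ (by simpa using hij)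

theorem AlmostStrictMono.init {n : ℕ} {σ : Fin (n + 1) → ℝ} (h : AlmostStrictMono σ) :
    AlmostStrictMono (Fin.init σ) :=
  fun i j hij => h i.castSucc j.castSucc (by simpa using hij)

/-- With at least three nodes the coincident branch of `dividedDiff` is never taken; hence no
derivative beyond the first ever occurs. -/
theorem AlmostStrictMono.ne_last {n : ℕ} {σ : Fin (n + 3) → ℝ} (h : AlmostStrictMono σ) :
    σ 0 ≠ σ (Fin.last (n + 2)) :=
  (h 0 (Fin.last (n + 2)) (by simp)).ne

theorem almostStrictMono_of_strictMono {n : ℕ} {σ : Fin n → ℝ} (h : StrictMono σ) :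
    AlmostStrictMono σ :=
  fun _ _ hij => h (Fin.lt_def.2 (by omega))

theorem almostStrictMono_comp_predAbove {n : ℕ} {τ : Fin n → ℝ} (h : StrictMono τ) (i : Fin n) :
    AlmostStrictMono (τ ∘ i.predAbove) := by
  intro a b hab
  apply h
  rw [Fin.lt_def, Fin.predAbove, Fin.predAbove]
  split_ifs with h1 h2 h2 <;>
    simp only [Fin.lt_def, Fin.val_castSucc, Fin.val_pred, Fin.coe_castPred] at h1 h2 ⊢ <;> omega

/-! ### Recursion and linearity of divided differences. -/

section Topological

variable {E F : Type*} [AddCommGroup E] [Module ℝ E] [TopologicalSpace E]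
  [AddCommGroup F] [Module ℝ F] [TopologicalSpace F]

theorem dividedDiff_succ_of_ne (f : ℝ → E) {n : ℕ} {τ : Fin (n + 2) → ℝ}
    (h : τ 0 ≠ τ (Fin.last (n + 1))) :
    dividedDiff f (n + 1) τ = (τ (Fin.last (n + 1)) - τ 0)⁻¹ •
      (dividedDiff f n (Fin.tail τ) - dividedDiff f n (Fin.init τ)) := by
  rw [dividedDiff, if_neg h]

theorem dividedDiff_one_of_eq (f : ℝ → E) {τ : Fin 2 → ℝ} (h : τ 0 = τ 1) :
    dividedDiff f 1 τ = deriv f (τ 0) := by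
  have h' : τ 0 = τ (Fin.last (0 + 1)) := h
  rw [dividedDiff, if_pos h']
  simp

/-- Without the division, the recursion also covers a double node: there are then only two nodes,
and both sides vanish. -/
theorem sub_smul_dividedDiff_succ (f : ℝ → E) {n : ℕ} {τ : Fin (n + 2) → ℝ}
    (hτ : AlmostStrictMono τ) :
    (τ (Fin.last (n + 1)) - τ 0) • dividedDiff f (n + 1) τ =
      dividedDiff f n (Fin.tail τ) - dividedDiff f n (Fin.init τ) := by
  by_cases h : τ 0 = τ (Fin.last (n + 1))
  · cases n with
    | zero =>
      have h' : τ 0 = τ 1 := h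
      rw [h, sub_self, zero_smul]
      simp [dividedDiff, Fin.tail, Fin.init, h']
    | succ n => exact absurd h hτ.ne_last
  · rw [dividedDiff_succ_of_ne f h, smul_smul,
      mul_inv_cancel₀ (sub_ne_zero.2 (Ne.symm h)), one_smul]

/-- A linear map that intertwines the values and the derivatives of two functions at the nodes
intertwines their divided differences. -/
theorem dividedDiff_map (L : E →ₗ[ℝ] F) {f : ℝ → E} {g : ℝ → F} :
    ∀ {n : ℕ} {σ : Fin (n + 1) → ℝ}, AlmostStrictMono σ → (∀ j, g (σ j) = L (f (σ j))) →
      (∀ j, deriv g (σ j) = L (deriv f (σ j))) → dividedDiff g n σ = L (dividedDiff f n σ)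
  | 0, σ, _, h0, _ => h0 0
  | n + 1, σ, hσ, h0, h1 => by
    by_cases h : σ 0 = σ (Fin.last (n + 1))
    · cases n with
      | zero => rw [dividedDiff_one_of_eq g h, dividedDiff_one_of_eq f h, h1]
      | succ n => exact absurd h hσ.ne_last
    · rw [dividedDiff_succ_of_ne f h, dividedDiff_succ_of_ne g h, map_smul, map_sub,
        dividedDiff_map L hσ.tail (fun j => h0 _) (fun j => h1 _),
        dividedDiff_map L hσ.init (fun j => h0 _) (fun j => h1 _)]

/-- At distinct nodes, no derivative is involved. -/
theorem dividedDiff_map_of_strictMono (L : E →ₗ[ℝ] F) {f : ℝ → E} {g : ℝ → F} :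
    ∀ {n : ℕ} {σ : Fin (n + 1) → ℝ}, StrictMono σ → (∀ j, g (σ j) = L (f (σ j))) →
      dividedDiff g n σ = L (dividedDiff f n σ)
  | 0, σ, _, h0 => h0 0
  | n + 1, σ, hσ, h0 => by
    have h : σ 0 ≠ σ (Fin.last (n + 1)) := (hσ Fin.last_pos).ne
    rw [dividedDiff_succ_of_ne f h, dividedDiff_succ_of_ne g h, map_smul, map_sub,
      dividedDiff_map_of_strictMono L (strictMono_tail hσ) (fun j => h0 _),
      dividedDiff_map_of_strictMono L (strictMono_init hσ) (fun j => h0 _)]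

theorem dividedDiff_mem (S : Submodule ℝ E) {f : ℝ → E} :
    ∀ {n : ℕ} {σ : Fin (n + 1) → ℝ}, StrictMono σ → (∀ j, f (σ j) ∈ S) → dividedDiff f n σ ∈ S
  | 0, σ, _, h0 => h0 0
  | n + 1, σ, hσ, h0 => by
    rw [dividedDiff_succ_of_ne f (hσ Fin.last_pos).ne]
    exact S.smul_mem _ (S.sub_mem (dividedDiff_mem S (strictMono_tail hσ) fun j => h0 _)
      (dividedDiff_mem S (strictMono_init hσ) fun j => h0 _))

end Topological

/-- The Leibniz rule for the factor `t`, whose own divided differences stop at order one. It drives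
the induction in `dividedDiff_pow`. -/
theorem dividedDiff_id_mul {f : ℝ → ℝ} (hf : Differentiable ℝ f) :
    ∀ {n : ℕ} {σ : Fin (n + 2) → ℝ}, AlmostStrictMono σ →
      dividedDiff (fun t => t * f t) (n + 1) σ =
        σ 0 * dividedDiff f (n + 1) σ + dividedDiff f n (Fin.tail σ)
  | n, σ, hσ => by
    by_cases h : σ 0 = σ (Fin.last (n + 1))
    · cases n with
      | zero =>
        have h' : σ 0 = σ 1 := h
        rw [dividedDiff_one_of_eq _ h, dividedDiff_one_of_eq _ h,
          deriv_fun_mul differentiableAt_fun_id hf.differentiableAt]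
        simp [dividedDiff, Fin.tail, h', add_comm]
      | succ n => exact absurd h hσ.ne_last
    · have hne : σ (Fin.last (n + 1)) - σ 0 ≠ 0 := sub_ne_zero.2 (Ne.symm h)
      rw [dividedDiff_succ_of_ne _ h, dividedDiff_succ_of_ne f h]
      cases n with
      | zero =>
        simp only [dividedDiff, Fin.tail, Fin.init, smul_eq_mul]
        simp at hne ⊢
        field_simp
        ring
      | succ n =>
        rw [dividedDiff_id_mul hf hσ.tail, dividedDiff_id_mul hf hσ.init]
        have h1 := sub_smul_dividedDiff_succ f hσ.tail
        have h2 : Fin.tail (Fin.init σ) = Fin.init (Fin.tail σ) := rfl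
        have h3 : Fin.tail σ (Fin.last (n + 1)) = σ (Fin.last (n + 2)) := rfl
        have h4 : Fin.init σ 0 = σ 0 := rfl
        rw [h2, h4]
        rw [h3] at h1
        simp only [smul_eq_mul] at h1 ⊢
        field_simp
        linear_combination -h1

theorem dividedDiff_const (c : ℝ) : ∀ {n : ℕ} {σ : Fin (n + 2) → ℝ}, AlmostStrictMono σ →
    dividedDiff (fun _ => c) (n + 1) σ = 0
  | n, σ, hσ => by
    by_cases h : σ 0 = σ (Fin.last (n + 1))
    · cases n with
      | zero => rw [dividedDiff_one_of_eq _ h, deriv_const]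
      | succ n => exact absurd h hσ.ne_last
    · rw [dividedDiff_succ_of_ne _ h]
      cases n with
      | zero => simp [dividedDiff]
      | succ n => rw [dividedDiff_const c hσ.tail, dividedDiff_const c hσ.init]; simp

theorem dividedDiff_pow {k n : ℕ} (hk : k < n) {σ : Fin (n + 1) → ℝ} (hσ : AlmostStrictMono σ) :
    dividedDiff (fun t => t ^ k) n σ = 0 := by
  induction k generalizing n with
  | zero =>
    obtain ⟨n, rfl⟩ := Nat.exists_eq_succ_of_ne_zero hk.ne'
    simpa using dividedDiff_const 1 hσ
  | succ k ih =>
    obtain ⟨n, rfl⟩ := Nat.exists_eq_succ_of_ne_zero (Nat.ne_zero_of_lt hk)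
    simp only [pow_succ']
    rw [dividedDiff_id_mul (by fun_prop) hσ, ih (by omega) hσ, ih (by omega) hσ.tail]
    simp

/-! ### The derivative of a divided difference in a node. -/

section Normed

variable {E : Type*} [NormedAddCommGroup E] [NormedSpace ℝ E]

/-- Removing the first node removes the dependence on it; this is the origin of the factor `δ_{i ≠
1}`. The formula of lower order enters as `ih`, so that `hasDerivAt_dividedDiff` can call this lemma
recursively. -/
theorem hasDerivAt_dividedDiff_tail {f : ℝ → E} {n : ℕ}
    (ih : ∀ {τ : Fin (n + 1) → ℝ}, StrictMono τ → ∀ i : Fin (n + 1),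
      DifferentiableAt ℝ f (τ i) → HasDerivAt (fun t => dividedDiff f n (Function.update τ i t))
        (dividedDiff f (n + 1) (τ ∘ i.predAbove)) (τ i))
    {τ : Fin (n + 2) → ℝ} (hτ : StrictMono τ) (i : Fin (n + 2))
    (hf : DifferentiableAt ℝ f (τ i)) :
    HasDerivAt (fun t => dividedDiff f n (Fin.tail (Function.update τ i t)))
      (if i ≠ 0 then dividedDiff f (n + 1) (Fin.tail (τ ∘ i.predAbove)) else 0) (τ i) := by
  induction i using Fin.cases with
  | zero =>
    simp only [Fin.tail_update_zero, ne_eq, not_true_eq_false, if_false]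
    exact hasDerivAt_const _ _
  | succ j =>
    rw [if_pos (Fin.succ_ne_zero j), tail_comp_predAbove_succ]
    simp only [Fin.tail_update_succ]
    exact ih (strictMono_tail hτ) j hf

theorem hasDerivAt_dividedDiff_init {f : ℝ → E} {n : ℕ}
    (ih : ∀ {τ : Fin (n + 1) → ℝ}, StrictMono τ → ∀ i : Fin (n + 1),
      DifferentiableAt ℝ f (τ i) → HasDerivAt (fun t => dividedDiff f n (Function.update τ i t))
        (dividedDiff f (n + 1) (τ ∘ i.predAbove)) (τ i))
    {τ : Fin (n + 2) → ℝ} (hτ : StrictMono τ) (i : Fin (n + 2))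
    (hf : DifferentiableAt ℝ f (τ i)) :
    HasDerivAt (fun t => dividedDiff f n (Fin.init (Function.update τ i t)))
      (if i ≠ Fin.last (n + 1) then dividedDiff f (n + 1) (Fin.init (τ ∘ i.predAbove)) else 0)
      (τ i) := by
  induction i using Fin.lastCases with
  | last =>
    simp only [Fin.init_update_last, ne_eq, not_true_eq_false, if_false]
    exact hasDerivAt_const _ _
  | cast j =>
    rw [if_pos (Fin.castSucc_lt_last j).ne, init_comp_predAbove_castSucc]
    simp only [Fin.init_update_castSucc]
    exact ih (strictMono_init hτ) j hf

/-- The derivative of a divided difference with respect to a node doubles this node. -/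
theorem hasDerivAt_dividedDiff {f : ℝ → E} : ∀ {n : ℕ} {τ : Fin (n + 1) → ℝ}, StrictMono τ →
    ∀ i : Fin (n + 1), DifferentiableAt ℝ f (τ i) →
      HasDerivAt (fun t => dividedDiff f n (Function.update τ i t))
        (dividedDiff f (n + 1) (τ ∘ i.predAbove)) (τ i)
  | 0, τ, hτ, i, hf => by
    obtain rfl : i = 0 := Fin.fin_one_eq_zero i
    rw [dividedDiff_one_of_eq f (by simp)]
    simpa [dividedDiff] using hf.hasDerivAt
  | n + 1, τ, hτ, i, hf => by
    have hlt : τ 0 < τ (Fin.last (n + 1)) := hτ Fin.last_pos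
    have hw0 : τ (Fin.last (n + 1)) - τ 0 ≠ 0 := (sub_pos.2 hlt).ne'
    have hd (j : Fin (n + 2)) : HasDerivAt (fun t => Function.update τ i t j)
        (if i = j then 1 else 0) (τ i) := by
      split_ifs with hij
      · subst hij
        simpa using hasDerivAt_id' (τ i)
      · simpa [Function.update_of_ne (Ne.symm hij)] using hasDerivAt_const (τ i) (τ j)
    have hev : ∀ᶠ t in 𝓝 (τ i), Function.update τ i t 0 ≠
        Function.update τ i t (Fin.last (n + 1)) :=
      ((hd 0).continuousAt.ne_iff_eventually_ne (hd (Fin.last (n + 1))).continuousAt).1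
        (by simpa using hlt.ne)
    have hEq : (fun t => dividedDiff f (n + 1) (Function.update τ i t)) =ᶠ[𝓝 (τ i)]
        fun t => (Function.update τ i t (Fin.last (n + 1)) - Function.update τ i t 0)⁻¹ •
          (dividedDiff f n (Fin.tail (Function.update τ i t)) -
            dividedDiff f n (Fin.init (Function.update τ i t))) := by
      filter_upwards [hev] with t ht
      exact dividedDiff_succ_of_ne f ht
    refine HasDerivAt.congr_of_eventuallyEq ?_ hEq
    have hT := hasDerivAt_dividedDiff_tail (fun h j => hasDerivAt_dividedDiff h j) hτ i hf
    have hI := hasDerivAt_dividedDiff_init (fun h j => hasDerivAt_dividedDiff h j) hτ i hf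
    have hW := (((hd (Fin.last (n + 1))).fun_sub (hd 0)).fun_inv
      (by simpa using hw0)).fun_smul (hT.fun_sub hI)
    refine hW.congr_deriv ?_
    have e0 : (τ ∘ i.predAbove) 0 = τ 0 := by simp
    have e1 : (τ ∘ i.predAbove) (Fin.last (n + 2)) = τ (Fin.last (n + 1)) := by
      simp
    rw [dividedDiff_succ_of_ne f (τ := τ ∘ i.predAbove) (by rw [e0, e1]; exact hlt.ne), e0, e1]
    simp only [Function.update_eq_self]
    -- The numerator is the width times `[τ] f`. At an end node the derivative of the reciprocal
    -- width thus contributes `[τ] f` divided by the width, which replaces the numerator term that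
    -- is constant there. At an interior node the width does not move.
    rw [← sub_smul_dividedDiff_succ f (almostStrictMono_of_strictMono hτ)]
    rcases eq_or_ne i 0 with rfl | hi0
    · have h1 : (0 : Fin (n + 2)) ≠ Fin.last (n + 1) := Fin.last_pos.ne
      rw [tail_comp_predAbove_zero]
      simp only [h1, if_true, if_false, ne_eq, not_true_eq_false, not_false_eq_true, smul_smul]
      match_scalars <;> field_simp
      ring
    · rcases eq_or_ne i (Fin.last (n + 1)) with rfl | hi1
      · rw [init_comp_predAbove_last]
        simp only [hi0, if_true, if_false, ne_eq, not_true_eq_false, not_false_eq_true, smul_smul]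
        match_scalars <;> field_simp
        ring
      · simp [hi0, hi1]

/-- The derivative of the numerator of a divided difference with respect to a node. -/
theorem hasDerivAt_dividedDiff_sub {f : ℝ → E} {n : ℕ} {τ : Fin (n + 2) → ℝ} (hτ : StrictMono τ)
    (i : Fin (n + 2)) (hf : DifferentiableAt ℝ f (τ i)) :
    HasDerivAt (fun t => dividedDiff f n (Fin.tail (Function.update τ i t)) -
        dividedDiff f n (Fin.init (Function.update τ i t)))
      ((if i ≠ 0 then dividedDiff f (n + 1) (Fin.tail (insertKnot τ (τ i))) else 0) -
        (if i ≠ Fin.last (n + 1) then dividedDiff f (n + 1) (Fin.init (insertKnot τ (τ i)))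
          else 0)) (τ i) := by
  rw [insertKnot_eq_comp_predAbove hτ]
  exact (hasDerivAt_dividedDiff_tail hasDerivAt_dividedDiff hτ i hf).fun_sub
    (hasDerivAt_dividedDiff_init hasDerivAt_dividedDiff hτ i hf)

end Normed

end DividedDifferences

/-! ### Sobolev spaces -/

section SobolevSpaces

open Filter Topology

/-- Knots are real parameters, so curves of distributions are differentiated over `ℝ`. Continuity is
tested on each Schwartz function. -/
instance : ContinuousSMul ℝ 𝓢'(ℝ, ℂ) where
  continuous_smul := by
    refine PointwiseConvergenceCLM.continuous_of_continuous_eval fun φ => ?_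
    have h : Continuous fun q : ℝ × 𝓢'(ℝ, ℂ) => q.1 • q.2 φ :=
      continuous_fst.smul ((continuous_eval_const φ).comp continuous_snd)
    exact h

theorem real_smul_eq (r : ℝ) (a : 𝓢'(ℝ, ℂ)) : r • a = (r : ℂ) • a :=
  (algebraMap_smul ℂ r a).symm

theorem toDistribution_toSobolev {s : ℝ} {u : 𝓢'(ℝ, ℂ)} (hu : MemSobolev s 2 u) :
    Sobolev.toDistribution (toSobolev s u) = u := by
  have h : toSobolev s u = (⟨u, hu⟩ : sobolevSubmodule s) := dif_pos hu
  rw [h]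
  rfl

theorem memSobolev_toDistribution {s : ℝ} (u : Sobolev s) :
    MemSobolev s 2 (Sobolev.toDistribution u) := Subtype.property u

theorem toSobolev_toDistribution {s : ℝ} (u : Sobolev s) :
    toSobolev s (Sobolev.toDistribution u) = u :=
  Sobolev.toDistribution_injective s (toDistribution_toSobolev (memSobolev_toDistribution u))

/-- The Bessel potential as an isometry from `H^s` onto `L²`. -/
def Sobolev.besselLpₗᵢ (s : ℝ) : Sobolev s ≃ₗᵢ[ℂ] Lp ℂ 2 (volume : Measure ℝ) where
  toLinearEquiv := LinearEquiv.ofBijective (Sobolev.besselLpₗ s)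
    ⟨Sobolev.besselLpₗ_injective s, fun f => by
      have hu : MemSobolev s 2 (besselPotential ℝ ℂ (-s)
          (Lp.toTemperedDistributionCLM ℂ (volume : Measure ℝ) 2 f)) := ⟨f, by simp⟩
      refine ⟨toSobolev s _, toTemperedDistribution_injective (Eq.trans
        (Sobolev.besselLp_spec (toSobolev s (besselPotential ℝ ℂ (-s)
          (Lp.toTemperedDistributionCLM ℂ (volume : Measure ℝ) 2 f)))) ?_)⟩
      rw [toDistribution_toSobolev hu]
      simp⟩
  norm_map' _ := rfl

instance (s : ℝ) : CompleteSpace (Sobolev s) :=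
  (Sobolev.besselLpₗᵢ s).toIsometryEquiv.completeSpace_iff.2 inferInstance

/-- This factorisation through `L²` makes the embedding into the tempered distributions continuous.
-/
theorem toDistribution_eq_besselPotential {s : ℝ} (u : Sobolev s) :
    Sobolev.toDistribution u = besselPotential ℝ ℂ (-s)
      (Lp.toTemperedDistributionCLM ℂ (volume : Measure ℝ) 2 (Sobolev.besselLpₗᵢ s u)) := by
  have h : Lp.toTemperedDistributionCLM ℂ (volume : Measure ℝ) 2 (Sobolev.besselLpₗᵢ s u) =
    besselPotential ℝ ℂ s (Sobolev.toDistribution u) := Sobolev.besselLp_spec u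
  rw [h]
  simp

/-- The embedding of `H^s` into the tempered distributions. -/
def Sobolev.toDistributionCLM (s : ℝ) : Sobolev s →L[ℂ] 𝓢'(ℝ, ℂ) where
  toLinearMap := Sobolev.toDistribution
  cont := by
    have h : ⇑(Sobolev.toDistribution (s := s)) = fun u => besselPotential ℝ ℂ (-s)
      (Lp.toTemperedDistributionCLM ℂ (volume : Measure ℝ) 2 (Sobolev.besselLpₗᵢ s u)) :=
      funext toDistribution_eq_besselPotential
    change Continuous ⇑(Sobolev.toDistribution (s := s))
    rw [h]
    exact (besselPotential ℝ ℂ (-s)).continuous.comp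
      ((Lp.toTemperedDistributionCLM ℂ (volume : Measure ℝ) 2).continuous.comp
        (Sobolev.besselLpₗᵢ s).continuous)

/-- A continuous operator on tempered distributions that maps `H^s` into `H^r`, as a
bounded operator between these spaces. -/
def Sobolev.mapCLM {s r : ℝ} (L : 𝓢'(ℝ, ℂ) →L[ℂ] 𝓢'(ℝ, ℂ))
    (hL : ∀ u, MemSobolev s 2 u → MemSobolev r 2 (L u)) : Sobolev s →L[ℂ] Sobolev r where
  toLinearMap := (L.toLinearMap.restrict (p := sobolevSubmodule s) (q := sobolevSubmodule r) hL :
    sobolevSubmodule s →ₗ[ℂ] sobolevSubmodule r)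
  cont := by
    -- Closed graph theorem: both norms are finer than the Hausdorff topology of tempered
    -- distributions, where `L` is continuous, so the two limits agree.
    refine LinearMap.continuous_of_seq_closed_graph (E := Sobolev s) (F := Sobolev r)
      (L.toLinearMap.restrict (p := sobolevSubmodule s) (q := sobolevSubmodule r) hL :
        sobolevSubmodule s →ₗ[ℂ] sobolevSubmodule r) fun u x y hu hy => ?_
    apply Sobolev.toDistribution_injective r
    have h1 := ((Sobolev.toDistributionCLM r).continuous.tendsto y).comp hy
    have h2 := ((L ∘L Sobolev.toDistributionCLM s).continuous.tendsto x).comp hu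
    exact tendsto_nhds_unique h1 h2

theorem toDistribution_mapCLM {s r : ℝ} (L : 𝓢'(ℝ, ℂ) →L[ℂ] 𝓢'(ℝ, ℂ))
    (hL : ∀ u, MemSobolev s 2 u → MemSobolev r 2 (L u)) (u : Sobolev s) :
    Sobolev.toDistribution (Sobolev.mapCLM L hL u) = L (Sobolev.toDistribution u) := rfl

theorem mapCLM_toSobolev {s r : ℝ} (L : 𝓢'(ℝ, ℂ) →L[ℂ] 𝓢'(ℝ, ℂ))
    (hL : ∀ u, MemSobolev s 2 u → MemSobolev r 2 (L u)) {u : 𝓢'(ℝ, ℂ)} (hu : MemSobolev s 2 u) :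
    Sobolev.mapCLM L hL (toSobolev s u) = toSobolev r (L u) := by
  apply Sobolev.toDistribution_injective r
  rw [toDistribution_mapCLM, toDistribution_toSobolev hu, toDistribution_toSobolev (hL u hu)]

theorem toSobolev_add {s : ℝ} {u v : 𝓢'(ℝ, ℂ)} (hu : MemSobolev s 2 u) (hv : MemSobolev s 2 v) :
    toSobolev s (u + v) = toSobolev s u + toSobolev s v := by
  apply Sobolev.toDistribution_injective s
  rw [map_add, toDistribution_toSobolev hu, toDistribution_toSobolev hv,
    toDistribution_toSobolev (hu.add hv)]

/-- The curve `u` of tempered distributions runs in `H^s` near the parameter `t`, and it is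
differentiable at `t` with derivative `v`, in the norm of `H^s`. -/
structure HasSobolevDerivAt (s : ℝ) (u : ℝ → 𝓢'(ℝ, ℂ)) (v : 𝓢'(ℝ, ℂ)) (t : ℝ) : Prop where
  mem : ∀ᶠ r in 𝓝 t, MemSobolev s 2 (u r)
  mem_deriv : MemSobolev s 2 v
  hasDerivAt : HasDerivAt (fun r => toSobolev s (u r)) (toSobolev s v) t

variable {s : ℝ} {u u₁ u₂ : ℝ → 𝓢'(ℝ, ℂ)} {v v₁ v₂ : 𝓢'(ℝ, ℂ)} {t : ℝ}

theorem HasSobolevDerivAt.congr (h : HasSobolevDerivAt s u₁ v t) (hu : ∀ᶠ r in 𝓝 t, u₂ r = u₁ r) :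
    HasSobolevDerivAt s u₂ v t where
  mem := by
    filter_upwards [h.mem, hu] with r h1 h2
    rwa [h2]
  mem_deriv := h.mem_deriv
  hasDerivAt := h.hasDerivAt.congr_of_eventuallyEq <| by
    filter_upwards [hu] with r hr
    rw [hr]

/-- The chain rule for the bounded operator `Sobolev.mapCLM`. The field `mem` is essential:
`toSobolev` is `0` off `H^s` and commutes with `L` only on members. -/
theorem HasSobolevDerivAt.map {r : ℝ} (h : HasSobolevDerivAt s u v t)
    (L : 𝓢'(ℝ, ℂ) →L[ℂ] 𝓢'(ℝ, ℂ)) (hL : ∀ w, MemSobolev s 2 w → MemSobolev r 2 (L w)) :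
    HasSobolevDerivAt r (fun x => L (u x)) (L v) t where
  mem := h.mem.mono fun x hx => hL _ hx
  mem_deriv := hL _ h.mem_deriv
  hasDerivAt := by
    have h1 := ((Sobolev.mapCLM L hL).restrictScalars ℝ).hasFDerivAt.comp_hasDerivAt t h.hasDerivAt
    simp only [ContinuousLinearMap.coe_restrictScalars', mapCLM_toSobolev L hL h.mem_deriv] at h1
    refine h1.congr_of_eventuallyEq ?_
    filter_upwards [h.mem] with x hx
    exact (mapCLM_toSobolev L hL hx).symm

theorem HasSobolevDerivAt.add (h₁ : HasSobolevDerivAt s u₁ v₁ t)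
    (h₂ : HasSobolevDerivAt s u₂ v₂ t) :
    HasSobolevDerivAt s (fun x => u₁ x + u₂ x) (v₁ + v₂) t where
  mem := by
    filter_upwards [h₁.mem, h₂.mem] with x hx₁ hx₂ using hx₁.add hx₂
  mem_deriv := h₁.mem_deriv.add h₂.mem_deriv
  hasDerivAt := by
    rw [toSobolev_add h₁.mem_deriv h₂.mem_deriv]
    refine (h₁.hasDerivAt.fun_add h₂.hasDerivAt).congr_of_eventuallyEq ?_
    filter_upwards [h₁.mem, h₂.mem] with x hx₁ hx₂ using toSobolev_add hx₁ hx₂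

theorem HasSobolevDerivAt.const_smul (h : HasSobolevDerivAt s u v t) (c : ℂ) :
    HasSobolevDerivAt s (fun x => c • u x) (c • v) t := by
  have h1 := h.map (r := s) (c • ContinuousLinearMap.id ℂ 𝓢'(ℝ, ℂ)) fun w hw => by
    rw [smul_apply, ContinuousLinearMap.id_apply]
    exact hw.smul c
  simp only [smul_apply, ContinuousLinearMap.id_apply] at h1
  exact h1

theorem memSobolev_derivCLM {w : 𝓢'(ℝ, ℂ)} (hw : MemSobolev s 2 w) :
    MemSobolev (s - 1) 2 (derivCLM ℂ w) := by
  have h := hw.lineDerivOp (m := (1 : ℝ))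
  exact h

/-- On the Fourier side this is `(1 + ξ²)⁻¹ + ξ² (1 + ξ²)⁻¹ = 1`; the constant arises because `∂²`
has the symbol `-(2πξ)²`. -/
theorem besselPotential_neg_two_sub (w : 𝓢'(ℝ, ℂ)) :
    besselPotential ℝ ℂ (-2) w + (-((2 * Real.pi : ℂ) ^ 2)⁻¹) •
      besselPotential ℝ ℂ (-2) (derivCLM ℂ (derivCLM ℂ w)) = w := by
  have h : Laplacian.laplacian w = derivCLM ℂ (derivCLM ℂ w) := by
    rw [TemperedDistribution.laplacian_eq_sum (OrthonormalBasis.singleton (Fin 1) ℝ)]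
    simp
    rfl
  rw [← h, besselPotential_neg_two_laplacian_eq]
  have hg₁ : (fun x : ℝ => (((1 + ‖x‖ ^ 2) ^ (-2 / 2 : ℝ) : ℝ) : ℂ)).HasTemperateGrowth := by
    fun_prop
  have hg₂ : (fun x : ℝ => ((‖x‖ ^ 2 * (1 + ‖x‖ ^ 2) ^ (-1 : ℝ) : ℝ) : ℂ)).HasTemperateGrowth := by
    fun_prop
  have hsum : fourierMultiplierCLM ℂ (fun x : ℝ => (((1 + ‖x‖ ^ 2) ^ (-2 / 2 : ℝ) : ℝ) : ℂ)) w +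
      fourierMultiplierCLM ℂ (fun x : ℝ => ((‖x‖ ^ 2 * (1 + ‖x‖ ^ 2) ^ (-1 : ℝ) : ℝ) : ℂ)) w =
        w := by
    have hone : (fun x : ℝ => (((1 + ‖x‖ ^ 2) ^ (-2 / 2 : ℝ) : ℝ) : ℂ)) +
        (fun x : ℝ => ((‖x‖ ^ 2 * (1 + ‖x‖ ^ 2) ^ (-1 : ℝ) : ℝ) : ℂ)) = fun _ => 1 := by
      funext x
      have hpos : (1 + ‖x‖ ^ 2) ≠ 0 := by positivity
      rw [Pi.add_apply, ← Complex.ofReal_add, show (-2 / 2 : ℝ) = -1 by norm_num,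
        Real.rpow_neg_one, ← one_add_mul, mul_inv_cancel₀ hpos, Complex.ofReal_one]
    rw [fourierMultiplierCLM_apply, fourierMultiplierCLM_apply, ← FourierTransform.fourierInv_add,
      ← add_apply, ← smulLeftCLM_add hg₁ hg₂, hone, smulLeftCLM_const, one_smul,
      FourierTransform.fourierInv_fourier_eq]
  refine Eq.trans ?_ hsum
  rw [besselPotential]
  congr 1
  rw [real_smul_eq, smul_smul]
  have hpi : (Real.pi : ℂ) ≠ 0 := by simp
  convert one_smul ℂ _ using 2
  push_cast
  field_simp

/-- A curve in `H^s` whose spatial derivative is differentiable in `H^s` is differentiable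
in `H^{s+1}`. -/
theorem HasSobolevDerivAt.of_derivCLM (h : HasSobolevDerivAt s u v t)
    (h' : HasSobolevDerivAt s (fun x => derivCLM ℂ (u x)) (derivCLM ℂ v) t) :
    HasSobolevDerivAt (s + 1) u v t := by
  -- In `besselPotential_neg_two_sub`, the first term gains two orders on `u`, and the second gains
  -- two and loses one on `∂u`; both therefore map `H^s` into `H^{s+1}`.
  have h1 := h.map (r := s + 1) (besselPotential ℝ ℂ (-2)) fun w hw => by
    rw [memSobolev_besselPotential_iff]
    exact hw.mono (by linarith)
  have h2 := (h'.map (r := s + 1) (besselPotential ℝ ℂ (-2) ∘L derivCLM ℂ) fun w hw => by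
    rw [ContinuousLinearMap.comp_apply, memSobolev_besselPotential_iff]
    exact (memSobolev_derivCLM hw).mono (by linarith)).const_smul (-((2 * Real.pi : ℂ) ^ 2)⁻¹)
  have h3 := h1.add h2
  simp only [ContinuousLinearMap.comp_apply, besselPotential_neg_two_sub] at h3
  exact h3

/-- The derivative of a curve of tempered distributions that comes from a differentiable curve in
a normed space. -/
theorem deriv_eq_of_comp {X : Type*} [NormedAddCommGroup X] [NormedSpace ℝ X]
    (L : X →L[ℝ] 𝓢'(ℝ, ℂ)) {f : ℝ → X} {f' : X} (hf : HasDerivAt f f' t)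
    (hu : ∀ᶠ r in 𝓝 t, u r = L (f r)) : deriv u t = L f' := by
  have h1 : HasFDerivAt u (L ∘L ContinuousLinearMap.toSpanSingleton ℝ f') t := by
    -- The target is not a normed space; the continuous linear map `L` carries over the remainder
    -- estimate in its form for topological vector spaces.
    rw [hasFDerivAt_iff_isLittleOTVS]
    have h2 := (L.isBigOTVS_comp (l := 𝓝 t)).trans_isLittleOTVS hf.hasFDerivAt.isLittleOTVS
    refine h2.congr' ?_ EventuallyEq.rfl
    filter_upwards [hu] with r hr
    simp [hr, hu.self_of_nhds]
  have h3 := h1.differentiableAt.hasFDerivAt.unique h1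
  rw [deriv, h3]
  simp

end SobolevSpaces

/-! ### Tempered functions and their weak derivatives -/

section TemperedFunctions

open Filter Topology

variable {f g : ℝ → ℝ}

theorem IsTempered.aestronglyMeasurable (hf : IsTempered f) : AEStronglyMeasurable f volume := by
  obtain ⟨k, hk⟩ := hf
  have : f = fun x => (1 + |x|) ^ k * (((1 + |x|) ^ k)⁻¹ * f x) := by
    funext x
    have hpos : (1 + |x|) ^ k ≠ 0 := by positivity
    field_simp
  rw [this]
  exact (Continuous.aestronglyMeasurable (by fun_prop)).mul hk.aestronglyMeasurable

theorem isTempered_of_le {k : ℕ} {C : ℝ} (hf : AEStronglyMeasurable f volume)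
    (h : ∀ x, |f x| ≤ C * (1 + |x|) ^ k) : IsTempered f := by
  -- The two extra powers leave the integrable weight `(1 + |x|)⁻²`.
  refine ⟨k + 2, ?_⟩
  have h1 : Integrable (fun x : ℝ => (1 + ‖x‖) ^ (-(2 : ℝ))) volume :=
    integrable_one_add_norm (by simp)
  refine (h1.const_mul C).mono' ?_ (Eventually.of_forall fun x => ?_)
  · refine AEStronglyMeasurable.mul (Continuous.aestronglyMeasurable ?_) hf
    exact Continuous.inv₀ (by fun_prop) fun x => by positivity
  · have hpos : 0 < 1 + |x| := by positivity
    rw [norm_mul, norm_inv, Real.norm_of_nonneg (by positivity), Real.norm_eq_abs,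
      Real.norm_eq_abs, Real.rpow_neg hpos.le, Real.rpow_two, pow_add, mul_inv,
      mul_comm, ← mul_assoc]
    refine mul_le_mul_of_nonneg_right ?_ (by positivity)
    rw [← div_eq_mul_inv, div_le_iff₀ (by positivity)]
    exact h x

theorem IsTempered.mono (hf : IsTempered f) (hg : AEStronglyMeasurable g volume)
    (h : ∀ x, |g x| ≤ |f x|) : IsTempered g := by
  obtain ⟨k, hk⟩ := hf
  refine ⟨k, hk.mono ?_ (Eventually.of_forall fun x => ?_)⟩
  · refine AEStronglyMeasurable.mul (Continuous.aestronglyMeasurable ?_) hg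
    exact Continuous.inv₀ (by fun_prop) fun x => by positivity
  · rw [norm_mul, norm_mul]
    exact mul_le_mul_of_nonneg_left (h x) (norm_nonneg _)

theorem IsTempered.const_mul (hf : IsTempered f) (c : ℝ) : IsTempered fun x => c * f x := by
  obtain ⟨k, hk⟩ := hf
  refine ⟨k, (hk.const_mul c).congr (Eventually.of_forall fun x => ?_)⟩
  ring

theorem IsTempered.bdd_mul (hf : IsTempered f) (hg : AEStronglyMeasurable g volume) {C : ℝ}
    (h : ∀ x, |g x| ≤ C) : IsTempered fun x => g x * f x := by
  refine (hf.const_mul C).mono (hg.mul hf.aestronglyMeasurable) fun x => ?_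
  rw [abs_mul, abs_mul]
  exact mul_le_mul_of_nonneg_right ((h x).trans (le_abs_self C)) (abs_nonneg _)

theorem IsTempered.add (hf : IsTempered f) (hg : IsTempered g) :
    IsTempered fun x => f x + g x := by
  have hm := hf.aestronglyMeasurable.add hg.aestronglyMeasurable
  obtain ⟨k, hk⟩ := hf
  obtain ⟨l, hl⟩ := hg
  have key : ∀ {h : ℝ → ℝ} {m n : ℕ}, m ≤ n → Integrable (fun x => ((1 + |x|) ^ m)⁻¹ * h x) →
      Integrable (fun x => ((1 + |x|) ^ n)⁻¹ * h x) := by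
    intro h m n hmn hi
    have e : (fun x => ((1 + |x|) ^ n)⁻¹ * h x) =
        fun x => ((1 + |x|) ^ (n - m))⁻¹ * (((1 + |x|) ^ m)⁻¹ * h x) := by
      funext x
      rw [← mul_assoc, ← mul_inv, ← pow_add, Nat.sub_add_cancel hmn]
    rw [e]
    refine hi.bdd_mul (c := 1) (Continuous.aestronglyMeasurable
      (Continuous.inv₀ (by fun_prop) fun x => by positivity)) (Eventually.of_forall fun x => ?_)
    rw [norm_inv, Real.norm_of_nonneg (by positivity)]
    exact inv_le_one_of_one_le₀ (one_le_pow₀ (by linarith [abs_nonneg x]))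
  refine ⟨max k l, ((key (le_max_left k l) hk).add (key (le_max_right k l) hl)).congr
    (Eventually.of_forall fun x => ?_)⟩
  simp [mul_add]

theorem isTempered_zero : IsTempered fun _ => 0 := ⟨0, by simp⟩

theorem IsTempered.indicator (hf : IsTempered f) {s : Set ℝ} (hs : MeasurableSet s) :
    IsTempered (s.indicator f) := by
  refine hf.mono (hf.aestronglyMeasurable.indicator hs) fun x => ?_
  by_cases hx : x ∈ s
  · rw [Set.indicator_of_mem hx]
  · rw [Set.indicator_of_notMem hx, abs_zero]
    exact abs_nonneg _

theorem isTempered_sub_pow (t : ℝ) (p : ℕ) : IsTempered fun x => (t - x) ^ p := by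
  refine isTempered_of_le (k := p) (C := (1 + |t|) ^ p)
    (Continuous.aestronglyMeasurable (by fun_prop)) fun x => ?_
  rw [abs_pow, ← mul_pow]
  refine pow_le_pow_left₀ (abs_nonneg _) ?_ p
  have h := abs_sub t x
  nlinarith [abs_nonneg t, abs_nonneg x, mul_nonneg (abs_nonneg t) (abs_nonneg x)]

theorem toDist_congr_ae (hf : IsTempered f) (hg : IsTempered g) (h : f =ᵐ[volume] g) :
    toDist f = toDist g := by
  ext φ
  rw [toDist_apply hf, toDist_apply hg]
  refine integral_congr_ae ?_
  filter_upwards [h] with x hx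
  rw [hx]

theorem toDist_add (hf : IsTempered f) (hg : IsTempered g) :
    toDist (fun x => f x + g x) = toDist f + toDist g := by
  ext φ
  rw [toDist_apply (hf.add hg), add_apply, toDist_apply hf, toDist_apply hg,
    ← integral_add (hf.integrable_mul φ) (hg.integrable_mul φ)]
  simp [mul_add]

theorem toDist_const_mul (hf : IsTempered f) (c : ℝ) :
    toDist (fun x => c * f x) = c • toDist f := by
  ext φ
  rw [toDist_apply (hf.const_mul c), real_smul_eq, smul_apply, toDist_apply hf, smul_eq_mul,
    ← integral_const_mul]
  congr 1
  funext x
  push_cast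
  ring

theorem toDist_zero : toDist (fun _ => 0) = 0 := by
  ext φ
  rw [toDist_apply isTempered_zero]
  simp

theorem IsTempered.sub (hf : IsTempered f) (hg : IsTempered g) :
    IsTempered fun x => f x - g x := by
  simpa [sub_eq_add_neg] using hf.add (hg.const_mul (-1))

theorem toDist_sub (hf : IsTempered f) (hg : IsTempered g) :
    toDist (fun x => f x - g x) = toDist f - toDist g := by
  have h := toDist_add hf (hg.const_mul (-1))
  have e : (-1 : ℝ) • toDist g = -toDist g := neg_one_smul ℝ (toDist g)
  rw [toDist_const_mul hg, e] at h
  simpa [sub_eq_add_neg] using h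

theorem isTempered_sum {ι : Type*} (s : Finset ι) {F : ι → ℝ → ℝ} (hF : ∀ i, IsTempered (F i)) :
    IsTempered fun x => ∑ i ∈ s, F i x := by
  classical
  induction s using Finset.induction_on with
  | empty => simpa using isTempered_zero
  | insert a s ha ih =>
    simp only [Finset.sum_insert ha]
    exact (hF a).add ih

theorem toDist_sum {ι : Type*} (s : Finset ι) {F : ι → ℝ → ℝ} (hF : ∀ i, IsTempered (F i)) :
    toDist (fun x => ∑ i ∈ s, F i x) = ∑ i ∈ s, toDist (F i) := by
  classical
  induction s using Finset.induction_on with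
  | empty => simpa using toDist_zero
  | insert a s ha ih =>
    simp only [Finset.sum_insert ha]
    rw [toDist_add (hF a) (isTempered_sum s hF), ih]

/-- The weak derivative of a differentiable function that is cut off at `t`. -/
theorem derivCLM_toDist_indicator {f f' : ℝ → ℝ} (hd : ∀ x, HasDerivAt f (f' x) x)
    (hf : IsTempered f) (hf' : IsTempered f') (t : ℝ) :
    derivCLM ℂ (toDist ((Set.Iio t).indicator f)) =
      toDist ((Set.Iio t).indicator f') - f t • delta t := by
  ext φ
  have ind (h : ℝ → ℝ) (ψ : 𝓢(ℝ, ℂ)) : ∫ x, ψ x * (((Set.Iio t).indicator h x : ℝ) : ℂ) =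
      ∫ x in Set.Iic t, ψ x * (h x : ℂ) := by
    rw [integral_Iic_eq_integral_Iio, ← integral_indicator measurableSet_Iio]
    congr 1
    funext x
    by_cases hx : x ∈ Set.Iio t
    · simp [Set.indicator_of_mem hx]
    · simp [Set.indicator_of_notMem hx]
  rw [derivCLM_apply_apply, map_neg, toDist_apply (hf.indicator measurableSet_Iio), sub_apply,
    toDist_apply (hf'.indicator measurableSet_Iio), ind, ind, real_smul_eq, smul_apply, delta_apply]
  have i1 := hf.integrable_mul (SchwartzMap.derivCLM ℂ ℂ φ)
  have i2 := hf'.integrable_mul φ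
  have hD (x : ℝ) : HasDerivAt (fun y => φ y * (f y : ℂ))
      (SchwartzMap.derivCLM ℂ ℂ φ x * (f x : ℂ) + φ x * (f' x : ℂ)) x := by
    rw [SchwartzMap.derivCLM_apply]
    exact (φ.hasDerivAt x).mul (hd x).ofReal_comp
  -- Integration by parts on `(-∞, t]`: the boundary term at `-∞` vanishes because `φ f` and its
  -- derivative are integrable, and the one at `t` is the Dirac term.
  have hlim := tendsto_zero_of_hasDerivAt_of_integrableOn_Iic (a := t) (fun x _ => hD x)
    (i1.add i2).integrableOn (hf.integrable_mul φ).integrableOn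
  have h := integral_Iic_of_hasDerivAt_of_tendsto (a := t) (hD t).continuousAt.continuousWithinAt
    (fun x _ => hD x) (i1.add i2).integrableOn hlim
  rw [integral_add i1.integrableOn i2.integrableOn] at h
  simp only [smul_eq_mul]
  linear_combination -h

theorem truncPow_sub_eq_indicator (p : ℕ) (t : ℝ) :
    (fun x => truncPow p (t - x)) = (Set.Iio t).indicator fun x => (t - x) ^ p := by
  funext x
  simp [truncPow, Set.indicator_apply]

theorem isTempered_truncPow (p : ℕ) (t : ℝ) : IsTempered fun x => truncPow p (t - x) := by
  rw [truncPow_sub_eq_indicator]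
  exact (isTempered_sub_pow t p).indicator measurableSet_Iio

theorem hasDerivAt_sub_pow (p : ℕ) (t x : ℝ) :
    HasDerivAt (fun x => (t - x) ^ p) (-(p : ℝ) * (t - x) ^ (p - 1)) x := by
  refine (((hasDerivAt_id' x).const_sub t).fun_pow p).congr_deriv ?_
  ring

theorem derivCLM_truncPowDist_zero (t : ℝ) : derivCLM ℂ (truncPowDist 0 t) = -delta t := by
  rw [truncPowDist, truncPow_sub_eq_indicator, derivCLM_toDist_indicator
    (hasDerivAt_sub_pow 0 t) (isTempered_sub_pow t 0)
    ((isTempered_sub_pow t _).const_mul _)]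
  simp [toDist_zero]

theorem derivCLM_truncPowDist_succ (p : ℕ) (t : ℝ) :
    derivCLM ℂ (truncPowDist (p + 1) t) = (-((p : ℝ) + 1)) • truncPowDist p t := by
  rw [truncPowDist, truncPow_sub_eq_indicator, derivCLM_toDist_indicator
    (hasDerivAt_sub_pow (p + 1) t) (isTempered_sub_pow t _)
    ((isTempered_sub_pow t _).const_mul _), truncPowDist,
    ← toDist_const_mul (isTempered_truncPow p t)]
  have h := truncPow_sub_eq_indicator p t
  have e : ((Set.Iio t).indicator fun x => -((p + 1 : ℕ) : ℝ) * (t - x) ^ (p + 1 - 1)) =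
      fun x => (-((p : ℝ) + 1)) * truncPow p (t - x) := by
    funext x
    rw [congrFun h x]
    by_cases hx : x ∈ Set.Iio t
    · simp [Set.indicator_of_mem hx]
    · simp [Set.indicator_of_notMem hx]
  have hz : (0 : ℝ) • delta t = 0 := zero_smul ℝ (delta t)
  rw [e, sub_self, zero_pow (Nat.succ_ne_zero p), hz, sub_zero]

/-! ### Polynomials in the knot -/

/-- The vector of monomials. -/
def monomials (p : ℕ) (t : ℝ) : Fin (p + 1) → ℝ := fun k => t ^ (k : ℕ)

/-- The derivative of the vector of monomials. -/
def monomialsDeriv (p : ℕ) (t : ℝ) : Fin (p + 1) → ℝ := fun k => (k : ℕ) * t ^ ((k : ℕ) - 1)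

/-- The coefficient of `t ^ k` in `(t - x) ^ p`. -/
def subPowCoeff (p : ℕ) (k : Fin (p + 1)) (x : ℝ) : ℝ :=
  (p.choose k : ℝ) * (0 - x) ^ (p - (k : ℕ))

theorem hasDerivAt_monomials (p : ℕ) (t : ℝ) :
    HasDerivAt (monomials p) (monomialsDeriv p t) t :=
  hasDerivAt_pi.2 fun k => hasDerivAt_pow (k : ℕ) t

theorem sum_monomials_mul (p : ℕ) (t x : ℝ) :
    ∑ k, monomials p t k * subPowCoeff p k x = (t - x) ^ p := by
  have h := add_pow t (0 - x) p
  rw [show t + (0 - x) = t - x by ring, Finset.sum_range] at h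
  rw [h]
  refine Finset.sum_congr rfl fun k _ => ?_
  simp only [monomials, subPowCoeff]
  ring

/-- Differentiating `sum_monomials_mul` in `t` and using uniqueness of the derivative avoids
identities for binomial coefficients. -/
theorem sum_monomialsDeriv_mul (p : ℕ) (t x : ℝ) :
    ∑ k, monomialsDeriv p t k * subPowCoeff p k x = (p : ℝ) * (t - x) ^ (p - 1) := by
  have h1 : HasDerivAt (fun r => ∑ k, monomials p r k * subPowCoeff p k x)
      (∑ k, monomialsDeriv p t k * subPowCoeff p k x) t :=
    HasDerivAt.fun_sum fun k _ => (hasDerivAt_pi.1 (hasDerivAt_monomials p t) k).mul_const _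
  simp only [sum_monomials_mul] at h1
  have h2 := ((hasDerivAt_id' t).sub_const x).fun_pow p
  exact (h1.unique h2).trans (by ring)

variable {ψ : ℝ → ℝ}

theorem isTempered_mul_subPowCoeff (hψ : Continuous ψ) {C : ℝ} (hC : ∀ x, |ψ x| ≤ C) (p : ℕ)
    (k : Fin (p + 1)) : IsTempered fun x => ψ x * subPowCoeff p k x :=
  ((isTempered_sub_pow 0 _).const_mul _).bdd_mul hψ.aestronglyMeasurable hC

theorem sum_smul_toDist (hψ : Continuous ψ) {C : ℝ} (hC : ∀ x, |ψ x| ≤ C) (p : ℕ)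
    (a : Fin (p + 1) → ℝ) :
    ∑ k, a k • toDist (fun x => ψ x * subPowCoeff p k x) =
      toDist fun x => ψ x * ∑ k, a k * subPowCoeff p k x := by
  have hk := isTempered_mul_subPowCoeff hψ hC p
  have h := toDist_sum Finset.univ fun k => (hk k).const_mul (a k)
  simp only [toDist_const_mul (hk _)] at h
  rw [← h]
  congr 1
  funext x
  rw [Finset.mul_sum]
  refine Finset.sum_congr rfl fun k _ => ?_
  ring

theorem memSobolev_toDist_of_hasCompactSupport (hψ : ContDiff ℝ (⊤ : ℕ∞) ψ)
    (hc : HasCompactSupport ψ) (s : ℝ) : MemSobolev s 2 (toDist ψ) := by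
  have hc' : HasCompactSupport (Complex.ofRealCLM ∘ ψ) := hc.comp_left rfl
  have hψ' : ContDiff ℝ (⊤ : ℕ∞) (Complex.ofRealCLM ∘ ψ) := by fun_prop
  obtain ⟨C, hC⟩ := hc.exists_bound_of_continuous hψ.continuous
  have ht : IsTempered ψ := isTempered_of_le (k := 0) (C := C) hψ.continuous.aestronglyMeasurable
    (by simpa using hC)
  have e : toDist ψ = ((hc'.toSchwartzMap hψ' : 𝓢(ℝ, ℂ)) : 𝓢'(ℝ, ℂ)) := by
    ext φ
    rw [toDist_apply ht, SchwartzMap.coe_apply]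
    simp
  rw [e]
  exact SchwartzMap.memSobolev _

/-- A polynomial in the parameter with smooth and compactly supported coefficients is
differentiable in every Sobolev space. -/
theorem hasSobolevDerivAt_mul_sub_pow (hψ : ContDiff ℝ (⊤ : ℕ∞) ψ) (hc : HasCompactSupport ψ)
    (s : ℝ) (p : ℕ) (t : ℝ) :
    HasSobolevDerivAt s (fun r => toDist fun x => ψ x * (r - x) ^ p)
      (toDist fun x => ψ x * ((p : ℝ) * (t - x) ^ (p - 1))) t := by
  obtain ⟨C, hC⟩ := hc.exists_bound_of_continuous hψ.continuous
  have hmem (k : Fin (p + 1)) : MemSobolev s 2 (toDist fun x => ψ x * subPowCoeff p k x) := by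
    refine memSobolev_toDist_of_hasCompactSupport ?_ hc.mul_right s
    refine hψ.mul ?_
    unfold subPowCoeff
    fun_prop
  -- The curve is a combination of these fixed elements with monomials in the parameter as
  -- coefficients, so only scalar functions are differentiated.
  let e : Fin (p + 1) → Sobolev s := fun k => toSobolev s (toDist fun x => ψ x * subPowCoeff p k x)
  have hdist (a : Fin (p + 1) → ℝ) : Sobolev.toDistribution (∑ k, a k • e k) =
      toDist fun x => ψ x * ∑ k, a k * subPowCoeff p k x := by
    rw [← sum_smul_toDist hψ.continuous hC, map_sum]
    refine Finset.sum_congr rfl fun k _ => ?_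
    rw [← Complex.coe_smul, map_smul, toDistribution_toSobolev (hmem k), real_smul_eq]
  have hm (r : ℝ) := hdist (monomials p r)
  have hm' := hdist (monomialsDeriv p t)
  simp only [sum_monomials_mul] at hm
  simp only [sum_monomialsDeriv_mul] at hm'
  refine ⟨Eventually.of_forall fun r => ?_, ?_, ?_⟩
  · rw [← hm]
    exact memSobolev_toDistribution _
  · rw [← hm']
    exact memSobolev_toDistribution _
  · simp only [← hm, ← hm', toSobolev_toDistribution]
    exact HasDerivAt.fun_sum fun k _ =>
      (hasDerivAt_pi.1 (hasDerivAt_monomials p t) k).smul_const (e k)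

end TemperedFunctions

/-! ### Differentiability in `L²` -/

section SquareIntegrable

open Filter Topology

/-- Differentiation in `L²` by dominated convergence. -/
theorem hasDerivAt_toLp {f : ℝ → ℝ → ℂ} {f' : ℝ → ℂ} {K : ℝ → ℝ} {t : ℝ}
    (hf : ∀ r, MemLp (f r) 2 (volume : Measure ℝ)) (hf' : MemLp f' 2 (volume : Measure ℝ))
    (hK : MemLp K 2 (volume : Measure ℝ))
    (hb : ∀ᶠ r in 𝓝 t, ∀ x, ‖f r x - f t x‖ ≤ K x * |r - t|) (hb' : ∀ x, ‖f' x‖ ≤ K x)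
    (hd : ∀ᵐ x, HasDerivAt (fun r => f r x) (f' x) t) :
    HasDerivAt (fun r => (hf r).toLp) hf'.toLp t := by
  rw [hasDerivAt_iff_tendsto_slope]
  have hs (r : ℝ) : MemLp ((r - t)⁻¹ • (f r - f t)) 2 (volume : Measure ℝ) :=
    ((hf r).sub (hf t)).const_smul _
  have he : slope (fun r => (hf r).toLp) t = fun r => (hs r).toLp := by
    funext r
    rw [slope_def_module]
    rfl
  rw [he, Lp.tendsto_Lp_iff_tendsto_eLpNorm'']
  have hm (r : ℝ) : MemLp ((r - t)⁻¹ • (f r - f t) - f') 2 (volume : Measure ℝ) := (hs r).sub hf'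
  simp only [fun r => (hm r).eLpNorm_eq_integral_rpow_norm two_ne_zero ENNReal.ofNat_ne_top]
  have hI : Tendsto (fun r => ∫ x, ‖((r - t)⁻¹ • (f r - f t) - f') x‖ ^ (2 : ENNReal).toReal)
      (𝓝[≠] t) (𝓝 (∫ _ : ℝ, (0 : ℝ))) := by
    -- The difference quotient and `f'` are each bounded by `K`.
    refine tendsto_integral_filter_of_dominated_convergence (fun x => (2 * K x) ^ 2) ?_ ?_ ?_ ?_
    · refine Eventually.of_forall fun r => ?_
      have := (hm r).aestronglyMeasurable.norm
      simpa [Pi.pow_def] using this.pow 2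
    · filter_upwards [nhdsWithin_le_nhds hb, self_mem_nhdsWithin] with r hr hne
      refine Eventually.of_forall fun x => ?_
      have hpos : 0 < |r - t| := abs_pos.2 (sub_ne_zero.2 hne)
      have h1 : ‖((r - t)⁻¹ • (f r - f t) - f') x‖ ≤ 2 * K x := by
        simp only [Pi.sub_apply, Pi.smul_apply]
        refine (norm_sub_le _ _).trans ?_
        rw [norm_smul, norm_inv, Real.norm_eq_abs]
        have h2 : |r - t|⁻¹ * ‖f r x - f t x‖ ≤ K x := by
          rw [inv_mul_le_iff₀ hpos, mul_comm]
          exact hr x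
        linarith [hb' x]
      simp only [ENNReal.toReal_ofNat, Real.rpow_two, Real.norm_eq_abs, abs_pow, abs_norm]
      exact pow_le_pow_left₀ (norm_nonneg _) h1 2
    · have := (hK.const_mul 2).integrable_sq
      simpa using this
    · filter_upwards [hd] with x hx
      rw [hasDerivAt_iff_tendsto_slope] at hx
      have h1 := (hx.sub_const (f' x)).norm
      rw [sub_self, norm_zero] at h1
      have h2 := h1.pow 2
      simpa [slope_def_module] using h2
  rw [integral_zero] at hI
  have h3 := (ENNReal.continuous_ofReal.tendsto _).comp
    (hI.rpow_const (p := ((2 : ENNReal).toReal)⁻¹) (Or.inr (by simp)))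
  simpa [Function.comp_def] using h3

theorem toDist_eq_toLp {f : ℝ → ℝ} (hf : IsTempered f)
    (h : MemLp (fun x => (f x : ℂ)) 2 (volume : Measure ℝ)) :
    toDist f = Lp.toTemperedDistributionCLM ℂ (volume : Measure ℝ) 2 h.toLp := by
  ext φ
  rw [toDist_apply hf, Lp.toTemperedDistributionCLM_apply, Lp.toTemperedDistribution_apply]
  refine integral_congr_ae ?_
  filter_upwards [h.coeFn_toLp] with x hx
  rw [hx, smul_eq_mul]

theorem toSobolev_zero_toDist {f : ℝ → ℝ} (hf : IsTempered f)
    (h : MemLp (fun x => (f x : ℂ)) 2 (volume : Measure ℝ)) :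
    MemSobolev 0 2 (toDist f) ∧ toSobolev 0 (toDist f) = (Sobolev.besselLpₗᵢ 0).symm h.toLp := by
  have h0 : MemSobolev 0 2 (toDist f) := memSobolev_zero_iff.2 ⟨_, toDist_eq_toLp hf h⟩
  refine ⟨h0, ?_⟩
  apply Sobolev.toDistribution_injective
  rw [toDistribution_toSobolev h0, toDistribution_eq_besselPotential,
    LinearIsometryEquiv.apply_symm_apply, neg_zero, besselPotential_zero, toDist_eq_toLp hf h]
  rfl

theorem hasSobolevDerivAt_zero_of_dominated {f : ℝ → ℝ → ℝ} {f' : ℝ → ℝ} {K : ℝ → ℝ} {t : ℝ}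
    (ht : ∀ r, IsTempered (f r)) (ht' : IsTempered f')
    (hf : ∀ r, MemLp (fun x => (f r x : ℂ)) 2 (volume : Measure ℝ))
    (hf' : MemLp (fun x => (f' x : ℂ)) 2 (volume : Measure ℝ))
    (hK : MemLp K 2 (volume : Measure ℝ))
    (hb : ∀ᶠ r in 𝓝 t, ∀ x, |f r x - f t x| ≤ K x * |r - t|) (hb' : ∀ x, |f' x| ≤ K x)
    (hd : ∀ᵐ x, HasDerivAt (fun r => f r x) (f' x) t) :
    HasSobolevDerivAt 0 (fun r => toDist (f r)) (toDist f') t where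
  mem := Eventually.of_forall fun r => (toSobolev_zero_toDist (ht r) (hf r)).1
  mem_deriv := (toSobolev_zero_toDist ht' hf').1
  hasDerivAt := by
    simp only [fun r => (toSobolev_zero_toDist (ht r) (hf r)).2,
      (toSobolev_zero_toDist ht' hf').2]
    have h := hasDerivAt_toLp hf hf' hK (by
      filter_upwards [hb] with r hr x
      rw [← Complex.ofReal_sub, Complex.norm_real]
      exact hr x) (by
      intro x
      rw [Complex.norm_real]
      exact hb' x) (by
      filter_upwards [hd] with x hx
      exact hx.ofReal_comp)
    exact (((Sobolev.besselLpₗᵢ 0).symm.toContinuousLinearEquiv.toContinuousLinearMap.restrictScalars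
      ℝ).hasFDerivAt.comp_hasDerivAt t h)

end SquareIntegrable

/-! ### Truncated powers with a cutoff -/

section Cutoff

open Filter Topology

/-- A smooth function that is `0` left of `M` and `1` right of `M + 1`. -/
def cutoff (M x : ℝ) : ℝ := Real.smoothTransition (x - M)

theorem contDiff_cutoff (M : ℝ) : ContDiff ℝ (⊤ : ℕ∞) (cutoff M) :=
  Real.smoothTransition.contDiff.comp (by fun_prop)

theorem abs_cutoff_le (M x : ℝ) : |cutoff M x| ≤ 1 :=
  abs_le.2 ⟨(by norm_num : (-1 : ℝ) ≤ 0).trans (Real.smoothTransition.nonneg (x - M)),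
    Real.smoothTransition.le_one _⟩

theorem cutoff_of_le {M x : ℝ} (h : x ≤ M) : cutoff M x = 0 :=
  Real.smoothTransition.zero_of_nonpos (by linarith)

theorem cutoff_of_ge {M x : ℝ} (h : M + 1 ≤ x) : cutoff M x = 1 :=
  Real.smoothTransition.one_of_one_le (by linarith)

theorem contDiff_deriv_cutoff (M : ℝ) : ContDiff ℝ (⊤ : ℕ∞) (deriv (cutoff M)) :=
  ((contDiff_succ_iff_deriv (n := (⊤ : ℕ∞))).1 (contDiff_cutoff M)).2.2

theorem hasDerivAt_cutoff (M x : ℝ) : HasDerivAt (cutoff M) (deriv (cutoff M) x) x :=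
  ((contDiff_cutoff M).differentiable (by simp)).differentiableAt.hasDerivAt

theorem deriv_cutoff_of_gt {M x : ℝ} (h : M + 1 < x) : deriv (cutoff M) x = 0 := by
  have : cutoff M =ᶠ[𝓝 x] fun _ => 1 := by
    filter_upwards [lt_mem_nhds h] with y hy using cutoff_of_ge hy.le
  rw [this.deriv_eq, deriv_const]

theorem deriv_cutoff_of_lt {M x : ℝ} (h : x < M) : deriv (cutoff M) x = 0 := by
  have : cutoff M =ᶠ[𝓝 x] fun _ => 0 := by
    filter_upwards [gt_mem_nhds h] with y hy using cutoff_of_le hy.le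
  rw [this.deriv_eq, deriv_const]

theorem hasCompactSupport_deriv_cutoff (M : ℝ) : HasCompactSupport (deriv (cutoff M)) := by
  refine HasCompactSupport.intro (isCompact_Icc (a := M) (b := M + 1)) fun x hx => ?_
  rcases lt_or_ge x M with h | h
  · exact deriv_cutoff_of_lt h
  · exact deriv_cutoff_of_gt (not_le.1 fun h' => hx ⟨h, h'⟩)

/-- The truncated power `x ↦ (t - x)_+^p`, cut off at `M`. -/
def cutPow (M : ℝ) (p : ℕ) (t x : ℝ) : ℝ := cutoff M x * truncPow p (t - x)

theorem isTempered_cutPow (M : ℝ) (p : ℕ) (t : ℝ) : IsTempered (cutPow M p t) :=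
  (isTempered_truncPow p t).bdd_mul (contDiff_cutoff M).continuous.aestronglyMeasurable
    (abs_cutoff_le M)

theorem cutPow_eq_indicator (M : ℝ) (p : ℕ) (t : ℝ) :
    cutPow M p t = (Set.Iio t).indicator fun x => cutoff M x * (t - x) ^ p := by
  funext x
  simp [cutPow, truncPow, Set.indicator_apply]

/-- False in degree `0`, since `0 ^ 0 = 1`. This form yields the Lipschitz bound
`abs_truncPow_sub_le`, which needs only upper bounds on the arguments. -/
theorem truncPow_succ_eq (p : ℕ) (y : ℝ) : truncPow (p + 1) y = max y 0 ^ (p + 1) := by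
  rw [truncPow]
  split_ifs with h
  · rw [max_eq_left h.le]
  · rw [max_eq_right (not_lt.1 h), zero_pow (Nat.succ_ne_zero p)]

theorem abs_truncPow_le (p : ℕ) {y R : ℝ} (hR : 0 ≤ R) (h : y ≤ R) : |truncPow p y| ≤ R ^ p := by
  rw [truncPow]
  split_ifs with hy
  · rw [abs_of_nonneg (by positivity)]
    exact pow_le_pow_left₀ hy.le h p
  · rw [abs_zero]
    positivity

theorem abs_truncPow_sub_le (p : ℕ) {y z R : ℝ} (hR : 0 ≤ R) (hy : y ≤ R) (hz : z ≤ R) :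
    |truncPow (p + 1) y - truncPow (p + 1) z| ≤ ((p : ℝ) + 1) * R ^ p * |y - z| := by
  rw [truncPow_succ_eq, truncPow_succ_eq]
  refine (abs_pow_sub_pow_le _ _ _).trans ?_
  have h1 := abs_max_sub_max_le_abs y z 0
  have h2 : max |max y 0| |max z 0| ≤ R := by
    rw [abs_of_nonneg (le_max_right y 0), abs_of_nonneg (le_max_right z 0)]
    exact max_le (max_le hy hR) (max_le hz hR)
  have h3 : max |max y 0| |max z 0| ^ p ≤ R ^ p :=
    pow_le_pow_left₀ (le_max_of_le_left (abs_nonneg _)) h2 p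
  have h4 : 0 ≤ max |max y 0| |max z 0| ^ p :=
    pow_nonneg (le_max_of_le_left (abs_nonneg _)) p
  rw [Nat.add_sub_cancel]
  push_cast
  calc |max y 0 - max z 0| * ((p : ℝ) + 1) * max |max y 0| |max z 0| ^ p
      ≤ |y - z| * ((p : ℝ) + 1) * R ^ p := by gcongr
    _ = _ := by ring

theorem hasDerivAt_truncPow (p : ℕ) {y : ℝ} (hy : y ≠ 0) :
    HasDerivAt (truncPow (p + 1)) (((p : ℝ) + 1) * truncPow p y) y := by
  rcases lt_or_gt_of_ne hy with h | h
  · have e : truncPow (p + 1) =ᶠ[𝓝 y] fun _ => 0 := by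
      filter_upwards [gt_mem_nhds h] with z hz
      simp [truncPow, hz.le]
    simpa [truncPow, not_lt.2 h.le] using (hasDerivAt_const y (0 : ℝ)).congr_of_eventuallyEq e
  · have e : truncPow (p + 1) =ᶠ[𝓝 y] fun z => z ^ (p + 1) := by
      filter_upwards [lt_mem_nhds h] with z hz
      simp [truncPow, hz]
    simpa [truncPow, h] using (hasDerivAt_pow (p + 1) y).congr_of_eventuallyEq e

theorem hasDerivAt_truncPow_sub (p : ℕ) {t x : ℝ} (h : x ≠ t) :
    HasDerivAt (fun r => truncPow (p + 1) (r - x)) (((p : ℝ) + 1) * truncPow p (t - x)) t := by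
  have h1 := (hasDerivAt_truncPow p (sub_ne_zero.2 h.symm)).comp_sub_const t x
  exact h1

/-- The support lies in `[M, t]`. The bound is uniform over `t ≤ T`, as domination over nearby knots
requires. -/
theorem abs_cutPow_le (M : ℝ) (p : ℕ) {t T R : ℝ} (hT : t ≤ T) (hR : 0 ≤ R) (hTR : T - M ≤ R)
    (x : ℝ) : |cutPow M p t x| ≤ (Set.Icc M T).indicator (fun _ => R ^ p) x := by
  by_cases hx : x ∈ Set.Icc M T
  · rw [Set.indicator_of_mem hx, cutPow, abs_mul]
    calc |cutoff M x| * |truncPow p (t - x)| ≤ 1 * R ^ p :=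
          mul_le_mul (abs_cutoff_le M x) (abs_truncPow_le p hR (by linarith [hx.1]))
            (abs_nonneg _) zero_le_one
      _ = R ^ p := one_mul _
  · rw [Set.indicator_of_notMem hx, cutPow]
    rcases lt_or_ge x M with h | h
    · simp [cutoff_of_le h.le]
    · have : T < x := not_le.1 fun h' => hx ⟨h, h'⟩
      simp [truncPow, (by linarith : t ≤ x)]

theorem memLp_cutPow (M : ℝ) (p : ℕ) (t : ℝ) :
    MemLp (fun x => (cutPow M p t x : ℂ)) 2 (volume : Measure ℝ) := by
  have h := memLp_indicator_const (μ := (volume : Measure ℝ)) 2 (measurableSet_Icc (a := M) (b := t))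
    (|t - M| ^ p) (Or.inr (by simp))
  refine h.mono' (Complex.continuous_ofReal.comp_aestronglyMeasurable
    (isTempered_cutPow M p t).aestronglyMeasurable) (Eventually.of_forall fun x => ?_)
  rw [Complex.norm_real]
  exact abs_cutPow_le M p le_rfl (abs_nonneg _) (le_abs_self _) x

theorem hasSobolevDerivAt_zero_cutPow (M : ℝ) (p : ℕ) (t : ℝ) :
    HasSobolevDerivAt 0 (fun r => toDist (cutPow M (p + 1) r))
      (((p : ℝ) + 1) • toDist (cutPow M p t)) t := by
  rw [← toDist_const_mul (isTempered_cutPow M p t)]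
  -- `R` bounds `r - x` for `M ≤ x` and `r ≤ t + 1`; the absolute value makes it nonnegative for
  -- every `M`.
  set R := |t + 1 - M|
  have hR : 0 ≤ R := abs_nonneg _
  have hRM : t + 1 - M ≤ R := le_abs_self _
  refine hasSobolevDerivAt_zero_of_dominated
    (K := (Set.Icc M (t + 1)).indicator fun _ => ((p : ℝ) + 1) * R ^ p)
    (fun r => isTempered_cutPow M (p + 1) r) ((isTempered_cutPow M p t).const_mul _)
    (fun r => memLp_cutPow M (p + 1) r) ?_
    (memLp_indicator_const 2 measurableSet_Icc _ (Or.inr (by simp))) ?_ (fun x => ?_) ?_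
  · have h := (memLp_cutPow M p t).const_mul ((p : ℂ) + 1)
    simpa using h
  · filter_upwards [gt_mem_nhds (lt_add_one t)] with r hr x
    by_cases hx : x ∈ Set.Icc M (t + 1)
    · rw [Set.indicator_of_mem hx, cutPow, cutPow, ← mul_sub, abs_mul]
      have h1 := abs_truncPow_sub_le p (y := r - x) (z := t - x) hR (by linarith [hx.1])
        (by linarith [hx.1])
      rw [sub_sub_sub_cancel_right] at h1
      calc _ ≤ 1 * (((p : ℝ) + 1) * R ^ p * |r - t|) :=
            mul_le_mul (abs_cutoff_le M x) h1 (abs_nonneg _) zero_le_one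
        _ = _ := one_mul _
    · rw [Set.indicator_of_notMem hx, zero_mul]
      have h1 := abs_cutPow_le M (p + 1) (t := r) hr.le hR hRM x
      have h2 := abs_cutPow_le M (p + 1) (t := t) (by linarith) hR hRM x
      rw [Set.indicator_of_notMem hx] at h1 h2
      rw [abs_nonpos_iff.1 h1, abs_nonpos_iff.1 h2]
      simp
  · rw [abs_mul, abs_of_nonneg (by positivity : (0 : ℝ) ≤ (p : ℝ) + 1)]
    have h := abs_cutPow_le M p (t := t) (by linarith) hR hRM x
    by_cases hx : x ∈ Set.Icc M (t + 1)
    · rw [Set.indicator_of_mem hx] at h ⊢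
      gcongr
    · rw [Set.indicator_of_notMem hx] at h ⊢
      rw [abs_nonpos_iff.1 h]
      simp
  -- The kink at `x = t` is a null set.
  · have hne : ∀ᵐ x : ℝ, x ≠ t := by simp [ae_iff]
    filter_upwards [hne] with x hx
    refine ((hasDerivAt_truncPow_sub p hx).const_mul (cutoff M x)).congr_deriv ?_
    rw [cutPow]
    ring

theorem isTempered_deriv_cutoff_mul (M : ℝ) (p : ℕ) (t : ℝ) :
    IsTempered fun x => deriv (cutoff M) x * (t - x) ^ p := by
  obtain ⟨C, hC⟩ := (hasCompactSupport_deriv_cutoff M).exists_bound_of_continuous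
    (contDiff_deriv_cutoff M).continuous
  exact (isTempered_sub_pow t p).bdd_mul
    (contDiff_deriv_cutoff M).continuous.aestronglyMeasurable hC

/-- The weak derivative of a truncated power with a cutoff. -/
theorem derivCLM_toDist_cutPow {M : ℝ} (p : ℕ) {t : ℝ} (ht : M + 1 < t) :
    derivCLM ℂ (toDist (cutPow M p t)) = (-(p : ℝ)) • toDist (cutPow M (p - 1) t) +
      toDist (fun x => deriv (cutoff M) x * (t - x) ^ p) - ((t - t) ^ p) • delta t := by
  have h1 := isTempered_deriv_cutoff_mul M p t
  have h2 : IsTempered fun x => cutoff M x * (-(p : ℝ) * (t - x) ^ (p - 1)) :=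
    ((isTempered_sub_pow t _).const_mul _).bdd_mul
      (contDiff_cutoff M).continuous.aestronglyMeasurable (abs_cutoff_le M)
  have h3 : IsTempered fun x => cutoff M x * (t - x) ^ p :=
    (isTempered_sub_pow t _).bdd_mul
      (contDiff_cutoff M).continuous.aestronglyMeasurable (abs_cutoff_le M)
  rw [cutPow_eq_indicator, derivCLM_toDist_indicator
    (fun x => (hasDerivAt_cutoff M x).fun_mul (hasDerivAt_sub_pow p t x)) h3 (h1.add h2),
    cutoff_of_ge ht.le, one_mul, ← toDist_const_mul (isTempered_cutPow M _ t),
    ← toDist_add ((isTempered_cutPow M _ t).const_mul _) h1]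
  congr 2
  funext x
  rw [cutPow_eq_indicator]
  by_cases hx : x ∈ Set.Iio t
  · simp only [Set.indicator_of_mem hx]
    ring
  · simp only [Set.indicator_of_notMem hx]
    -- From `t > M + 1` onwards the cutoff is constant, so its derivative needs no truncation at
    -- `t`.
    rw [deriv_cutoff_of_gt (ht.trans_le (not_lt.1 hx))]
    simp

end Cutoff

/-! ### Cut-off truncated powers as differentiable curves in Sobolev spaces. -/

section Curves

open Filter Topology

variable {M t : ℝ}

/-- The boundary factor `(t - t) ^ p` is `1` for `p = 0` and `0` otherwise, so the Dirac
distribution appears in degree `0` only. -/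
theorem derivCLM_toDist_cutPow_zero (ht : M + 1 < t) :
    derivCLM ℂ (toDist (cutPow M 0 t)) =
      toDist (fun x => deriv (cutoff M) x * (t - x) ^ 0) - delta t := by
  have h := derivCLM_toDist_cutPow 0 ht
  rw [real_smul_eq, real_smul_eq] at h
  rw [h]
  simp only [Nat.cast_zero, neg_zero, Complex.ofReal_zero, pow_zero, Complex.ofReal_one]
  module

theorem derivCLM_toDist_cutPow_succ (p : ℕ) (ht : M + 1 < t) :
    derivCLM ℂ (toDist (cutPow M (p + 1) t)) = (-((p : ℂ) + 1)) • toDist (cutPow M p t) +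
      toDist (fun x => deriv (cutoff M) x * (t - x) ^ (p + 1)) := by
  have h := derivCLM_toDist_cutPow (p + 1) ht
  rw [real_smul_eq, real_smul_eq, sub_self, zero_pow (Nat.succ_ne_zero p), Nat.add_sub_cancel] at h
  rw [h]
  push_cast
  module

theorem hasSobolevDerivAt_deriv_cutoff_mul (s M : ℝ) (p : ℕ) (t : ℝ) :
    HasSobolevDerivAt s (fun r => toDist fun x => deriv (cutoff M) x * (r - x) ^ (p + 1))
      (((p : ℂ) + 1) • toDist fun x => deriv (cutoff M) x * (t - x) ^ p) t := by
  have h := hasSobolevDerivAt_mul_sub_pow (contDiff_deriv_cutoff M)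
    (hasCompactSupport_deriv_cutoff M) s (p + 1) t
  have e : toDist (fun x => deriv (cutoff M) x * (((p + 1 : ℕ) : ℝ) * (t - x) ^ (p + 1 - 1))) =
      ((p : ℂ) + 1) • toDist fun x => deriv (cutoff M) x * (t - x) ^ p := by
    have e1 := toDist_const_mul (isTempered_deriv_cutoff_mul M p t) ((p : ℝ) + 1)
    rw [real_smul_eq] at e1
    push_cast at e1
    rw [← e1]
    congr 1
    funext x
    push_cast
    ring
  rwa [e] at h

/-- A truncated power of degree `p + 1` with a cutoff is differentiable in its knot, in the norm
of `H^k` for `k ≤ p`. -/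
theorem hasSobolevDerivAt_cutPow_succ (ht : M + 1 < t) {k p : ℕ} (hk : k ≤ p) :
    HasSobolevDerivAt k (fun r => toDist (cutPow M (p + 1) r))
      (((p : ℂ) + 1) • toDist (cutPow M p t)) t := by
  induction k generalizing p with
  | zero =>
    have h := hasSobolevDerivAt_zero_cutPow M p t
    rw [real_smul_eq] at h
    push_cast at h
    simpa using h
  | succ k ih =>
    obtain ⟨q, rfl⟩ := Nat.exists_eq_succ_of_ne_zero (Nat.ne_zero_of_lt hk)
    rw [Nat.cast_succ]
    refine (ih (Nat.le_of_succ_le hk)).of_derivCLM ?_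
    -- The spatial derivative of degree `q + 2` is a multiple of degree `q + 1` plus a smooth term;
    -- the induction hypothesis in order `k ≤ q` applies to it. One Sobolev order costs one degree.
    have h := ((ih (p := q) (by omega)).const_smul (-(((q + 1 : ℕ) : ℂ) + 1))).add
      (hasSobolevDerivAt_deriv_cutoff_mul k M (q + 1) t)
    have e : derivCLM ℂ (((((q + 1 : ℕ) : ℂ)) + 1) • toDist (cutPow M (q + 1) t)) =
        (-(((q + 1 : ℕ) : ℂ) + 1)) • ((q : ℂ) + 1) • toDist (cutPow M q t) +
        (((q + 1 : ℕ) : ℂ) + 1) • toDist fun x => deriv (cutoff M) x * (t - x) ^ (q + 1) := by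
      rw [map_smul, derivCLM_toDist_cutPow_succ q ht]
      module
    rw [Nat.succ_eq_add_one, e]
    refine h.congr ?_
    filter_upwards [lt_mem_nhds ht] with r hr
    exact derivCLM_toDist_cutPow_succ (q + 1) hr

/-- The derivative of the truncated power with a cutoff with respect to its knot. -/
def cutPowDeriv (M : ℝ) : ℕ → ℝ → 𝓢'(ℝ, ℂ)
  | 0, t => delta t
  | p + 1, t => ((p : ℂ) + 1) • toDist (cutPow M p t)

/-- In degree `0` the formula for the spatial derivative in degree `1` is read backwards: the curve
is minus that derivative, plus a smooth term, and `∂` maps `L²` boundedly into `H^{-1}`. -/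
theorem hasSobolevDerivAt_cutPow (ht : M + 1 < t) (p : ℕ) :
    HasSobolevDerivAt ((p : ℝ) - 1) (fun r => toDist (cutPow M p r)) (cutPowDeriv M p t) t := by
  cases p with
  | zero =>
    have h1 := ((hasSobolevDerivAt_cutPow_succ ht le_rfl (p := 0)).map (derivCLM ℂ)
      fun w hw => memSobolev_derivCLM hw).const_smul (-1)
    have h2 := h1.add (hasSobolevDerivAt_deriv_cutoff_mul (((0 : ℕ) : ℝ) - 1) M 0 t)
    have e : (-1 : ℂ) • derivCLM ℂ ((((0 : ℕ) : ℂ) + 1) • toDist (cutPow M 0 t)) +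
        (((0 : ℕ) : ℂ) + 1) • (toDist fun x => deriv (cutoff M) x * (t - x) ^ 0) =
          cutPowDeriv M 0 t := by
      rw [map_smul, derivCLM_toDist_cutPow_zero ht, cutPowDeriv, Nat.cast_zero]
      module
    rw [e] at h2
    refine h2.congr ?_
    filter_upwards [lt_mem_nhds ht] with r hr
    rw [derivCLM_toDist_cutPow_succ 0 hr, Nat.cast_zero]
    module
  | succ p =>
    have h := hasSobolevDerivAt_cutPow_succ ht (le_refl p)
    rwa [show ((p + 1 : ℕ) : ℝ) - 1 = p by push_cast; ring]

/-- A truncated power depends on `t - x` only, so `∂_x` equals `-∂_t` up to the smooth term from the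
cutoff, and `∂_t` stays in `H^{p-1}`. Mapping by `∂_x` alone would lose one order. -/
theorem memSobolev_derivCLM_cutPow (ht : M + 1 < t) (p : ℕ) :
    MemSobolev ((p : ℝ) - 1) 2 (derivCLM ℂ (toDist (cutPow M p t))) := by
  have h1 := (hasSobolevDerivAt_cutPow ht p).mem_deriv
  have h2 := (hasSobolevDerivAt_mul_sub_pow (contDiff_deriv_cutoff M)
    (hasCompactSupport_deriv_cutoff M) ((p : ℝ) - 1) p t).mem.self_of_nhds
  cases p with
  | zero =>
    rw [derivCLM_toDist_cutPow_zero ht]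
    exact h2.sub h1
  | succ p =>
    have e : derivCLM ℂ (toDist (cutPow M (p + 1) t)) =
        toDist (fun x => deriv (cutoff M) x * (t - x) ^ (p + 1)) - cutPowDeriv M (p + 1) t := by
      rw [derivCLM_toDist_cutPow_succ p ht, cutPowDeriv]
      module
    rw [e]
    exact h2.sub h1

theorem memSobolev_delta (z : ℝ) : MemSobolev (-1) 2 (delta z) := by
  have h := (hasSobolevDerivAt_cutPow (M := z - 2) (t := z) (by linarith) 0).mem_deriv
  rw [Nat.cast_zero, zero_sub] at h
  exact h

/-! ### Truncated powers as curves of tempered distributions -/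

/-- The curve of truncated powers with a cutoff in `H^{p-1}`. -/
def cutPowSobolev (M : ℝ) (p : ℕ) (t : ℝ) : Sobolev ((p : ℝ) - 1) :=
  toSobolev ((p : ℝ) - 1) (toDist (cutPow M p t))

theorem toDistribution_cutPowSobolev (ht : M + 1 < t) (p : ℕ) :
    Sobolev.toDistribution (cutPowSobolev M p t) = toDist (cutPow M p t) :=
  toDistribution_toSobolev (hasSobolevDerivAt_cutPow ht p).mem.self_of_nhds

theorem continuous_one_sub_cutoff (M : ℝ) : Continuous fun x => 1 - cutoff M x :=
  continuous_const.sub (contDiff_cutoff M).continuous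

theorem abs_one_sub_cutoff_le (M x : ℝ) : |1 - cutoff M x| ≤ 2 := by
  have h1 := abs_cutoff_le M x
  have h2 := abs_sub 1 (cutoff M x)
  rw [abs_one] at h2
  linarith

theorem isTempered_one_sub_cutoff_mul (M : ℝ) (p : ℕ) (t : ℝ) :
    IsTempered fun x => (1 - cutoff M x) * (t - x) ^ p :=
  (isTempered_sub_pow t p).bdd_mul (continuous_one_sub_cutoff M).aestronglyMeasurable
    (abs_one_sub_cutoff_le M)

/-- To the right of `t` the factor `1 - cutoff M` vanishes, so the second summand is a genuine
polynomial in `t`, without truncation. -/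
theorem truncPowDist_eq_add (ht : M + 1 < t) (p : ℕ) :
    truncPowDist p t =
      toDist (cutPow M p t) + toDist fun x => (1 - cutoff M x) * (t - x) ^ p := by
  rw [truncPowDist, ← toDist_add (isTempered_cutPow M p t) (isTempered_one_sub_cutoff_mul M p t)]
  congr 1
  funext x
  rw [cutPow]
  rcases lt_or_ge x t with h | h
  · simp only [truncPow, sub_pos, h, if_true]
    ring
  · rw [cutoff_of_ge (ht.le.trans h)]
    simp [truncPow]

/-- The distribution that is determined by an element of `H^{p-1}` and the coefficients of a
polynomial. -/
def assembleCLM (M : ℝ) (p : ℕ) :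
    Sobolev ((p : ℝ) - 1) × (Fin (p + 1) → ℝ) →L[ℝ] 𝓢'(ℝ, ℂ) where
  toFun q := Sobolev.toDistribution q.1 +
    ∑ k, q.2 k • toDist fun x => (1 - cutoff M x) * subPowCoeff p k x
  map_add' q r := by
    simp only [Prod.fst_add, Prod.snd_add, map_add, Pi.add_apply]
    rw [add_add_add_comm, ← Finset.sum_add_distrib]
    congr 1
    exact Finset.sum_congr rfl fun k _ => add_smul (q.2 k) (r.2 k)
      (toDist fun x => (1 - cutoff M x) * subPowCoeff p k x)
  map_smul' c q := by
    simp only [Prod.smul_fst, Prod.smul_snd, RingHom.id_apply, Pi.smul_apply]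
    refine Eq.trans ?_ (smul_add c (Sobolev.toDistribution q.1)
      (∑ k, q.2 k • toDist fun x => (1 - cutoff M x) * subPowCoeff p k x)).symm
    congr 1
    refine Eq.trans ?_ Finset.smul_sum.symm
    exact Finset.sum_congr rfl fun k _ => smul_assoc c (q.2 k)
      (toDist fun x => (1 - cutoff M x) * subPowCoeff p k x)
  cont := by
    refine ((Sobolev.toDistributionCLM _).continuous.comp continuous_fst).add ?_
    refine continuous_finsetSum _ fun k _ => ?_
    exact ((continuous_apply k).comp continuous_snd).smul continuous_const

theorem assembleCLM_apply (M : ℝ) (p : ℕ) (u : Sobolev ((p : ℝ) - 1)) (a : Fin (p + 1) → ℝ) :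
    assembleCLM M p (u, a) = Sobolev.toDistribution u +
      toDist fun x => (1 - cutoff M x) * ∑ k, a k * subPowCoeff p k x := by
  rw [← sum_smul_toDist (continuous_one_sub_cutoff M) (abs_one_sub_cutoff_le M)]
  rfl

/-- The curve whose image under `assembleCLM` is the curve of truncated powers. -/
def splitCurve (M : ℝ) (p : ℕ) (t : ℝ) : Sobolev ((p : ℝ) - 1) × (Fin (p + 1) → ℝ) :=
  (cutPowSobolev M p t, monomials p t)

theorem truncPowDist_eq_assembleCLM (ht : M + 1 < t) (p : ℕ) :
    truncPowDist p t = assembleCLM M p (splitCurve M p t) := by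
  rw [splitCurve, assembleCLM_apply, truncPowDist_eq_add ht, toDistribution_cutPowSobolev ht]
  simp only [sum_monomials_mul]

theorem hasDerivAt_cutPowSobolev (ht : M + 1 < t) (p : ℕ) :
    HasDerivAt (cutPowSobolev M p) (toSobolev ((p : ℝ) - 1) (cutPowDeriv M p t)) t :=
  (hasSobolevDerivAt_cutPow ht p).hasDerivAt

theorem hasDerivAt_splitCurve (ht : M + 1 < t) (p : ℕ) :
    HasDerivAt (splitCurve M p)
      (toSobolev ((p : ℝ) - 1) (cutPowDeriv M p t), monomialsDeriv p t) t :=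
  (hasDerivAt_cutPowSobolev ht p).prodMk (hasDerivAt_monomials p t)

theorem deriv_truncPowDist_eq_assembleCLM (ht : M + 1 < t) (p : ℕ) :
    deriv (truncPowDist p) t = assembleCLM M p
      (toSobolev ((p : ℝ) - 1) (cutPowDeriv M p t), monomialsDeriv p t) := by
  refine deriv_eq_of_comp (assembleCLM M p) (hasDerivAt_splitCurve ht p) ?_
  filter_upwards [lt_mem_nhds ht] with r hr
  exact truncPowDist_eq_assembleCLM hr p

/-- In positive degree the derivative in the knot is a function; this settles double knots in
`toDist_dividedDiff`. -/
theorem deriv_truncPowDist_succ (p : ℕ) (t : ℝ) :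
    deriv (truncPowDist (p + 1)) t = toDist fun x => ((p : ℝ) + 1) * truncPow p (t - x) := by
  have ht : t - 2 + 1 < t := by linarith
  rw [deriv_truncPowDist_eq_assembleCLM ht, assembleCLM_apply,
    toDistribution_toSobolev (hasSobolevDerivAt_cutPow ht (p + 1)).mem_deriv]
  simp only [sum_monomialsDeriv_mul]
  have e1 := toDist_const_mul (isTempered_one_sub_cutoff_mul (t - 2) p t) ((p : ℝ) + 1)
  have e2 := toDist_const_mul (isTempered_truncPow p t) ((p : ℝ) + 1)
  have e3 : (fun x => (1 - cutoff (t - 2) x) * (((p + 1 : ℕ) : ℝ) * (t - x) ^ (p + 1 - 1))) =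
      fun x => ((p : ℝ) + 1) * ((1 - cutoff (t - 2) x) * (t - x) ^ p) := by
    funext x
    push_cast
    ring
  rw [real_smul_eq] at e1 e2
  rw [e3, e1, e2, ← truncPowDist, truncPowDist_eq_add ht, cutPowDeriv]
  push_cast
  module

/-- The normalised B-spline is a divided difference in the Sobolev space. -/
theorem normBSplineDist_eq_toDistribution {p : ℕ} {σ : Fin (p + 2) → ℝ} (hσ : AlmostStrictMono σ)
    (hM : ∀ j, M + 1 < σ j) :
    normBSplineDist p σ =
      Sobolev.toDistribution (dividedDiff (cutPowSobolev M p) (p + 1) σ) := by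
  have h1 : normBSplineDist p σ = assembleCLM M p (dividedDiff (splitCurve M p) (p + 1) σ) := by
    refine dividedDiff_map (assembleCLM M p).toLinearMap hσ
      (fun j => truncPowDist_eq_assembleCLM (hM j) p) fun j => ?_
    rw [deriv_truncPowDist_eq_assembleCLM (hM j), (hasDerivAt_splitCurve (hM j) p).deriv]
    rfl
  have h2 : dividedDiff (cutPowSobolev M p) (p + 1) σ =
      (dividedDiff (splitCurve M p) (p + 1) σ).1 := by
    refine dividedDiff_map (f := splitCurve M p) (g := cutPowSobolev M p)
      (LinearMap.fst ℝ _ _) hσ (fun j => rfl) fun j => ?_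
    rw [(hasDerivAt_splitCurve (hM j) p).deriv, (hasDerivAt_cutPowSobolev (hM j) p).deriv]
    rfl
  -- The second component consists of monomials of degree at most `p`, annihilated by divided
  -- differences of order `p + 1`.
  have h3 : (dividedDiff (splitCurve M p) (p + 1) σ).2 = 0 := by
    funext k
    rw [Pi.zero_apply, ← dividedDiff_pow k.2 hσ]
    refine (dividedDiff_map (f := splitCurve M p) (g := fun r => r ^ (k : ℕ))
      (LinearMap.proj k ∘ₗ LinearMap.snd ℝ _ _) hσ (fun j => rfl) fun j => ?_).symm
    rw [(hasDerivAt_splitCurve (hM j) p).deriv, (hasDerivAt_pow (k : ℕ) (σ j)).deriv]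
    rfl
  rw [h1, h2, ← Prod.mk.eta (p := dividedDiff (splitCurve M p) (p + 1) σ), h3, assembleCLM_apply]
  simp [toDist_zero]

end Curves

/-! ### B-splines -/

section BSplines

open Filter Topology

variable {M : ℝ}

/-- The alternative excludes a double knot in degree `0`, where a Dirac distribution arises.
Otherwise the pointwise derivative at a double knot is the distributional one except possibly at `x`
equal to the knot, a null set. -/
theorem toDist_dividedDiff {p : ℕ} : ∀ {n : ℕ} {σ : Fin (n + 1) → ℝ}, AlmostStrictMono σ →
    (1 ≤ p ∨ StrictMono σ) →
      IsTempered (fun x => dividedDiff (fun t => truncPow p (t - x)) n σ) ∧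
      dividedDiff (truncPowDist p) n σ =
        toDist fun x => dividedDiff (fun t => truncPow p (t - x)) n σ
  | 0, σ, _, _ => ⟨isTempered_truncPow p (σ 0), rfl⟩
  | n + 1, σ, hσ, hp => by
    by_cases h : σ 0 = σ (Fin.last (n + 1))
    · cases n with
      | zero =>
        obtain hp | hp := hp
        · obtain ⟨q, rfl⟩ := Nat.exists_eq_succ_of_ne_zero (Nat.one_le_iff_ne_zero.1 hp)
          have ht := (isTempered_truncPow q (σ 0)).const_mul ((q : ℝ) + 1)
          have hae : (fun x => ((q : ℝ) + 1) * truncPow q (σ 0 - x)) =ᵐ[volume]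
              fun x => deriv (fun t => truncPow (q + 1) (t - x)) (σ 0) := by
            have hne : ∀ᵐ x : ℝ, x ≠ σ 0 := by simp [ae_iff]
            filter_upwards [hne] with x hx
            exact (hasDerivAt_truncPow_sub q hx).deriv.symm
          have ht' : IsTempered fun x => deriv (fun t => truncPow (q + 1) (t - x)) (σ 0) := by
            obtain ⟨k, hk⟩ := ht
            refine ⟨k, hk.congr ?_⟩
            filter_upwards [hae] with x hx
            rw [hx]
          simp only [Nat.succ_eq_add_one, dividedDiff_one_of_eq _ h]
          exact ⟨ht', (deriv_truncPowDist_succ q (σ 0)).trans (toDist_congr_ae ht ht' hae)⟩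
        · exact absurd h (hp Fin.last_pos).ne
      | succ n => exact absurd h hσ.ne_last
    · obtain ⟨t1, e1⟩ := toDist_dividedDiff hσ.tail (hp.imp_right strictMono_tail)
      obtain ⟨t2, e2⟩ := toDist_dividedDiff hσ.init (hp.imp_right strictMono_init)
      simp only [dividedDiff_succ_of_ne _ h, smul_eq_mul]
      refine ⟨(t1.sub t2).const_mul _, ?_⟩
      rw [toDist_const_mul (t1.sub t2), toDist_sub t1 t2, e1, e2]

theorem normBSplineDist_eq_toDist {p : ℕ} {σ : Fin (p + 2) → ℝ} (hσ : AlmostStrictMono σ)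
    (hp : 1 ≤ p ∨ StrictMono σ) :
    IsTempered (normBSpline p σ) ∧ normBSplineDist p σ = toDist (normBSpline p σ) :=
  toDist_dividedDiff hσ hp

theorem toDist_bSpline {p : ℕ} {τ : Fin (p + 2) → ℝ} (hτ : StrictMono τ) :
    toDist (bSpline p τ) = (width τ : ℂ) • normBSplineDist p τ := by
  obtain ⟨h1, h2⟩ := normBSplineDist_eq_toDist (almostStrictMono_of_strictMono hτ) (Or.inr hτ)
  rw [h2, ← real_smul_eq, ← toDist_const_mul h1]
  rfl

theorem toDist_bSpline_eq_toDistribution {p : ℕ} {τ : Fin (p + 2) → ℝ} (hτ : StrictMono τ)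
    (hM : ∀ j, M + 1 < τ j) :
    toDist (bSpline p τ) = Sobolev.toDistribution
      (dividedDiff (cutPowSobolev M p) p (Fin.tail τ) -
        dividedDiff (cutPowSobolev M p) p (Fin.init τ)) := by
  have h := sub_smul_dividedDiff_succ (cutPowSobolev M p) (almostStrictMono_of_strictMono hτ)
  rw [toDist_bSpline hτ, normBSplineDist_eq_toDistribution (almostStrictMono_of_strictMono hτ) hM,
    ← h, ← Complex.coe_smul, map_smul]
  rfl

theorem add_one_lt_of_strictMono {n : ℕ} {τ : Fin (n + 1) → ℝ} (hτ : StrictMono τ)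
    (j : Fin (n + 1)) : τ 0 - 2 + 1 < τ j := by
  have := hτ.monotone (Fin.zero_le j)
  linarith

theorem memSobolev_bSpline {p : ℕ} {τ : Fin (p + 2) → ℝ} (hτ : StrictMono τ) :
    MemSobolev ((p : ℝ) - 1) 2 (toDist (bSpline p τ)) := by
  rw [toDist_bSpline_eq_toDistribution hτ (add_one_lt_of_strictMono hτ)]
  exact memSobolev_toDistribution _

/-- At distinct knots a divided difference is a linear combination of values, and each value has its
spatial derivative in `H^{p-1}`. -/
theorem memSobolev_derivCLM_bSpline {p : ℕ} {τ : Fin (p + 2) → ℝ} (hτ : StrictMono τ) :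
    MemSobolev ((p : ℝ) - 1) 2 (derivCLM ℂ (toDist (bSpline p τ))) := by
  have hM := add_one_lt_of_strictMono hτ
  set M := τ 0 - 2
  let L : Sobolev ((p : ℝ) - 1) →L[ℝ] 𝓢'(ℝ, ℂ) :=
    (derivCLM ℂ ∘L Sobolev.toDistributionCLM ((p : ℝ) - 1)).restrictScalars ℝ
  let S : Submodule ℝ 𝓢'(ℝ, ℂ) := (sobolevSubmodule ((p : ℝ) - 1)).restrictScalars ℝ
  have h1 : dividedDiff (fun r => L (cutPowSobolev M p r)) (p + 1) τ ∈ S := by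
    refine dividedDiff_mem S hτ fun j => ?_
    have h := memSobolev_derivCLM_cutPow (hM j) p
    rw [← toDistribution_cutPowSobolev (hM j) p] at h
    exact h
  rw [dividedDiff_map_of_strictMono (f := cutPowSobolev M p) L.toLinearMap hτ fun j => rfl] at h1
  rw [toDist_bSpline hτ, normBSplineDist_eq_toDistribution (almostStrictMono_of_strictMono hτ) hM,
    map_smul]
  exact MemSobolev.smul _ h1

theorem derivCLM_bSpline_zero {τ : Fin 2 → ℝ} (hτ : StrictMono τ) :
    derivCLM ℂ (toDist (bSpline 0 τ)) = delta (τ 0) - delta (τ 1) := by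
  have hlt : τ 0 < τ 1 := hτ (by simp)
  have hne : ((τ 1 : ℂ) - τ 0) ≠ 0 := by
    rw [← Complex.ofReal_sub]
    exact Complex.ofReal_ne_zero.2 (sub_pos.2 hlt).ne'
  have h : normBSplineDist 0 τ =
      ((((τ 1 - τ 0)⁻¹ : ℝ)) : ℂ) • (truncPowDist 0 (τ 1) - truncPowDist 0 (τ 0)) := by
    rw [← real_smul_eq]
    exact dividedDiff_succ_of_ne (truncPowDist 0) (τ := τ) (n := 0) hlt.ne
  rw [toDist_bSpline hτ, h, smul_smul]
  have hw : (width τ : ℂ) * ((((τ 1 - τ 0)⁻¹ : ℝ)) : ℂ) = 1 := by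
    have : width τ = τ 1 - τ 0 := rfl
    rw [this]
    push_cast
    exact mul_inv_cancel₀ hne
  rw [hw, map_smul, map_sub, derivCLM_truncPowDist_zero, derivCLM_truncPowDist_zero]
  module

/-- `∂_x` passes inside and lowers the degree to `p` while the order stays `p + 2`; the width then
cancels the last quotient and leaves two normalised B-splines. -/
theorem derivCLM_bSpline_succ {p : ℕ} {τ : Fin (p + 3) → ℝ} (hτ : StrictMono τ) :
    derivCLM ℂ (toDist (bSpline (p + 1) τ)) = toDist (fun x => -((p : ℝ) + 1) *
      (normBSpline p (Fin.tail τ) x - normBSpline p (Fin.init τ) x)) := by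
  have hτ' := almostStrictMono_of_strictMono hτ
  obtain ⟨t1, e1⟩ := normBSplineDist_eq_toDist (p := p) hτ'.tail (Or.inr (strictMono_tail hτ))
  obtain ⟨t2, e2⟩ := normBSplineDist_eq_toDist (p := p) hτ'.init (Or.inr (strictMono_init hτ))
  rw [toDist_const_mul (t1.sub t2), toDist_sub t1 t2, ← e1, ← e2, toDist_bSpline hτ, map_smul]
  let D : 𝓢'(ℝ, ℂ) →L[ℝ] 𝓢'(ℝ, ℂ) := (derivCLM ℂ).restrictScalars ℝ
  let A : 𝓢'(ℝ, ℂ) →ₗ[ℝ] 𝓢'(ℝ, ℂ) := (-((p : ℝ) + 1)) • LinearMap.id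
  have h1 : dividedDiff (fun r => D (truncPowDist (p + 1) r)) (p + 2) τ =
      derivCLM ℂ (normBSplineDist (p + 1) τ) :=
    dividedDiff_map_of_strictMono (f := truncPowDist (p + 1)) D.toLinearMap hτ fun j => rfl
  have h2 : dividedDiff (fun r => D (truncPowDist (p + 1) r)) (p + 2) τ =
      A (dividedDiff (truncPowDist p) (p + 2) τ) :=
    dividedDiff_map_of_strictMono (f := truncPowDist p) A hτ
      fun j => derivCLM_truncPowDist_succ p (τ j)
  have h3 := sub_smul_dividedDiff_succ (truncPowDist p) hτ'
  rw [← h1, h2, ← real_smul_eq]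
  change width τ • (-((p : ℝ) + 1)) • dividedDiff (truncPowDist p) (p + 2) τ =
    (-((p : ℝ) + 1)) • (dividedDiff (truncPowDist p) (p + 1) (Fin.tail τ) -
      dividedDiff (truncPowDist p) (p + 1) (Fin.init τ))
  rw [← h3]
  exact smul_comm _ _ _

theorem almostStrictMono_insertKnot {n : ℕ} {τ : Fin n → ℝ} (hτ : StrictMono τ) (i : Fin n) :
    AlmostStrictMono (insertKnot τ (τ i)) := by
  rw [insertKnot_eq_comp_predAbove hτ]
  exact almostStrictMono_comp_predAbove hτ i

theorem knotDerivDist_eq_toDistribution {p : ℕ} {τ : Fin (p + 2) → ℝ} (hτ : StrictMono τ)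
    (hM : ∀ j, M + 1 < τ j) (i : Fin (p + 2)) :
    knotDerivDist p τ i = Sobolev.toDistribution
      ((if i ≠ 0 then dividedDiff (cutPowSobolev M p) (p + 1) (Fin.tail (insertKnot τ (τ i)))
          else 0) -
        (if i ≠ Fin.last (p + 1) then
          dividedDiff (cutPowSobolev M p) (p + 1) (Fin.init (insertKnot τ (τ i))) else 0)) := by
  have hs := almostStrictMono_insertKnot hτ i
  have hn (j) : M + 1 < insertKnot τ (τ i) j := by
    rw [insertKnot_eq_comp_predAbove hτ]
    exact hM _
  rw [knotDerivDist, map_sub, normBSplineDist_eq_toDistribution hs.tail fun j => hn _,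
    normBSplineDist_eq_toDistribution hs.init fun j => hn _]
  split_ifs <;> simp

theorem hasDerivAt_bSpline {p : ℕ} {τ : Fin (p + 2) → ℝ} (hτ : StrictMono τ) (i : Fin (p + 2)) :
    MemSobolev ((p : ℝ) - 1) 2 (knotDerivDist p τ i) ∧
      HasDerivAt (fun t => toSobolev ((p : ℝ) - 1) (toDist (bSpline p (Function.update τ i t))))
        (toSobolev ((p : ℝ) - 1) (knotDerivDist p τ i)) (τ i) := by
  have hM := add_one_lt_of_strictMono hτ
  set M := τ 0 - 2
  have hc (j : Fin (p + 2)) : ContinuousAt (fun t => Function.update τ i t j) (τ i) := by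
    fun_prop
  have h0 (j : Fin (p + 2)) : Function.update τ i (τ i) j = τ j := by simp
  have hev1 : ∀ᶠ t in 𝓝 (τ i), ∀ j, M + 1 < Function.update τ i t j :=
    eventually_all.2 fun j => (hc j).eventually_const_lt (by simpa only [h0] using hM j)
  -- Under a small move of one knot the order persists, so near `τ i` the B-spline remains a
  -- difference of divided differences in `H^{p-1}`.
  have hev2 : ∀ᶠ t in 𝓝 (τ i), StrictMono (Function.update τ i t) := by
    have h : ∀ᶠ t in 𝓝 (τ i), ∀ j k, j < k → Function.update τ i t j < Function.update τ i t k := by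
      refine eventually_all.2 fun j => eventually_all.2 fun k => ?_
      by_cases hjk : j < k
      · filter_upwards [(hc j).eventually_lt (hc k) (by simpa only [h0] using hτ hjk)] with t ht _
        exact ht
      · exact Eventually.of_forall fun t h => absurd h hjk
    filter_upwards [h] with t ht j k using ht j k
  rw [knotDerivDist_eq_toDistribution hτ hM, toSobolev_toDistribution]
  refine ⟨memSobolev_toDistribution _, ?_⟩
  refine (hasDerivAt_dividedDiff_sub hτ i
    (hasDerivAt_cutPowSobolev (hM i) p).differentiableAt).congr_of_eventuallyEq ?_
  filter_upwards [hev1, hev2] with t h1 h2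
  rw [toDist_bSpline_eq_toDistribution h2 h1, toSobolev_toDistribution]

theorem knotDerivDist_eq_toDist {p : ℕ} (hp : 1 ≤ p) {τ : Fin (p + 2) → ℝ} (hτ : StrictMono τ)
    (i : Fin (p + 2)) : knotDerivDist p τ i = toDist (knotDeriv p τ i) := by
  have hs := almostStrictMono_insertKnot hτ i
  have key (c : Prop) [Decidable c] {σ : Fin (p + 2) → ℝ} (hσ : AlmostStrictMono σ) :
      IsTempered (fun x => if c then normBSpline p σ x else 0) ∧
        (if c then normBSplineDist p σ else 0) =
          toDist fun x => if c then normBSpline p σ x else 0 := by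
    split_ifs
    · exact normBSplineDist_eq_toDist hσ (Or.inl hp)
    · exact ⟨isTempered_zero, toDist_zero.symm⟩
  obtain ⟨t1, e1⟩ := key (i ≠ 0) hs.tail
  obtain ⟨t2, e2⟩ := key (i ≠ Fin.last (p + 1)) hs.init
  rw [knotDerivDist, e1, e2, ← toDist_sub t1 t2]
  rfl

end BSplines

end FreeKnot

end

/-! ### The spatial and knot derivatives together. -/

theorem mainTheorem5 :
    -- spatial derivative: membership in the Sobolev space, degree zero, positive degree
    (∀ (p : ℕ) (τ : Fin (p + 2) → ℝ), τ ∈ FreeKnot.knotVectors (p + 2) →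
      MemSobolev ((p : ℝ) - 1) 2 (FreeKnot.toDist (FreeKnot.bSpline p τ)) ∧
      MemSobolev ((p : ℝ) - 1) 2 (derivCLM ℂ (FreeKnot.toDist (FreeKnot.bSpline p τ)))) ∧
    (∀ z : ℝ, MemSobolev (-1) 2 (delta z)) ∧
    (∀ τ : Fin 2 → ℝ, τ ∈ FreeKnot.knotVectors 2 →
      derivCLM ℂ (FreeKnot.toDist (FreeKnot.bSpline 0 τ)) = delta (τ 0) - delta (τ 1)) ∧
    (∀ (p : ℕ) (τ : Fin (p + 3) → ℝ), τ ∈ FreeKnot.knotVectors (p + 3) →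
      derivCLM ℂ (FreeKnot.toDist (FreeKnot.bSpline (p + 1) τ)) =
        FreeKnot.toDist (fun x => -((p : ℝ) + 1) *
          (FreeKnot.normBSpline p (Fin.tail τ) x - FreeKnot.normBSpline p (Fin.init τ) x))) ∧
    -- derivative with respect to the knots, in the norm of the Sobolev space
    (∀ (p : ℕ) (τ : Fin (p + 2) → ℝ), τ ∈ FreeKnot.knotVectors (p + 2) → ∀ i : Fin (p + 2),
      MemSobolev ((p : ℝ) - 1) 2 (FreeKnot.knotDerivDist p τ i) ∧
      HasDerivAt
        (fun t : ℝ => FreeKnot.toSobolev ((p : ℝ) - 1)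
          (FreeKnot.toDist (FreeKnot.bSpline p (Function.update τ i t))))
        (FreeKnot.toSobolev ((p : ℝ) - 1) (FreeKnot.knotDerivDist p τ i)) (τ i) ∧
      -- in positive degree the derivative is given by the normalised B-splines as functions
      (1 ≤ p → FreeKnot.knotDerivDist p τ i = FreeKnot.toDist (FreeKnot.knotDeriv p τ i))) := by
  refine ⟨fun p τ hτ => ⟨FreeKnot.memSobolev_bSpline hτ, FreeKnot.memSobolev_derivCLM_bSpline hτ⟩,
    FreeKnot.memSobolev_delta, fun τ hτ => FreeKnot.derivCLM_bSpline_zero hτ,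
    fun p τ hτ => FreeKnot.derivCLM_bSpline_succ hτ, fun p τ hτ i => ?_⟩
  obtain ⟨h1, h2⟩ := FreeKnot.hasDerivAt_bSpline hτ i
  exact ⟨h1, h2, fun hp => FreeKnot.knotDerivDist_eq_toDist hp hτ i⟩
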